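/- Let $0\le\Omega\le 1/2$, $0\le\alpha\le 1$, and let $F$ be the distribution of a real random variable $X$ with $\mathbb{E}X^2<\infty$ and $\Pr\{X=0\}=0$; write $\mu_F$, $\sigma_F^2$ for its mean and variance. Let the source $\mathcal{X}(\Omega,F)$ be the set of all sequences $(\mathbf{x}^n)$, $\mathbf{x}^n\in\mathbb{R}^n$, such that $\mathbf{x}^n$ has exactly $\lfloor\Omega n\rfloor$ nonzero entries and the empirical distribution function of these nonzero entries converges to $F$ uniformly on $\mathbb{R}$ as $n\to\infty$. A vector $\mathbf{x}\in\mathbb{R}^n$ with sparsity pattern $\mathbf{s}=\{i:x_i\neq 0\}$ and $k=|\mathbf{s}|$ is observed through $\mathbf{Y}=\mathbf{A}\mathbf{x}+\mathbf{W}$, where $\mathbf{A}$ is an $m\times n$ random matrix with an arbitrary law such that $\mathbb{E}[\mathrm{tr}(\mathbf{A}\mathbf{A}^T)]=m$, and $\mathbf{W}$ has i.i.d. standard Gaussian entries and is independent of $\mathbf{A}$. An estimator $\hat{\mathbf{s}}(\mathbf{Y},\mathbf{A},k)$ outputs a set of $k$ indices, and $d(\mathbf{s},\hat{\mathbf{s}})=1-|\mathbf{s}\cap\hat{\mathbf{s}}|/|\mathbf{s}|$.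 A pair $(\rho,\alpha)$ with $\rho\ge 0$ is achievable if for each $n$ there are a $\lceil\rho n\rceil\times n$ random matrix $\mathbf{A}$ as above and an estimator such that, for every sequence $(\mathbf{x}^n)\in\mathcal{X}(\Omega,F)$, $\Pr\{d(\mathbf{s},\hat{\mathbf{s}}(\mathbf{Y},\mathbf{A},k))>\alpha\}\to 0$ as $n\to\infty$. Let $\rho(\alpha)\in[0,\infty]$ be the infimum of all $\rho\ge0$ such that $(\rho,\alpha)$ is achievable ($\infty$ if there is none). Then $$\rho(\alpha)\ \ge\ \frac{2R(\Omega,\alpha)}{\log\big(1+V(\Omega,F)\big)},$$ where $V(\Omega,F)=\Omega(1-\Omega)\mu_F^2+\Omega\sigma_F^2$, $H(p)=-p\log p-(1-p)\log(1-p)$ with the natural logarithm, and $$R(\Omega,\alpha)=\begin{cases}H(\Omega)-\Omega H(\alpha)-(1-\Omega)H\big(\tfrac{\Omega\alpha}{1-\Omega}\big), & \alpha<1-\Omega,\\ 0, & \alpha\ge 1-\Omega.\end{cases}$$ (For $\Omega=0$ the right-hand side is $0/0$ and is read as $0$.) -/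

import Mathlib

open MeasureTheory ProbabilityTheory Filter Topology

noncomputable section

namespace SparsityPattern

/-- The product (entrywise) σ-algebra on matrices. -/
instance matrixMeasurableSpace (m n : ℕ) : MeasurableSpace (Matrix (Fin m) (Fin n) ℝ) :=
  inferInstanceAs (MeasurableSpace (Fin m → Fin n → ℝ))

/-- The sparsity pattern of a vector: the set of indices of its nonzero entries. -/
def pattern {n : ℕ} (x : Fin n → ℝ) : Finset (Fin n) :=
  Finset.univ.filter fun i => x i ≠ 0

/-- The distortion `d(s, s') = 1 - |s ∩ s'| / |s|`. -/
def distortion {n : ℕ} (s s' : Finset (Fin n)) : ℝ :=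
  1 - ((s ∩ s').card : ℝ) / (s.card : ℝ)

/-- A random `m × n` sampling matrix, given by its law, with the normalization
`E[tr (A Aᵀ)] = m`. The entries may be dependent and have arbitrary distributions. -/
structure SamplingMatrix (m n : ℕ) where
  law : Measure (Matrix (Fin m) (Fin n) ℝ)
  isProbabilityMeasure : IsProbabilityMeasure law
  integrable_trace : Integrable (fun A : Matrix (Fin m) (Fin n) ℝ => (A * A.transpose).trace) law
  integral_trace : ∫ A : Matrix (Fin m) (Fin n) ℝ, (A * A.transpose).trace ∂law = m

/-- A sparsity pattern estimator `ŝ(y, A, k)`: it sees the samples, the sampling matrix and the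
sparsity `k`, and outputs (measurably) a set of size `k`. -/
structure Estimator (m n : ℕ) where
  toFun : (Fin m → ℝ) → Matrix (Fin m) (Fin n) ℝ → ℕ → Finset (Fin n)
  card_eq : ∀ y A k, k ≤ n → (toFun y A k).card = k
  measurable : ∀ (k : ℕ) (t : Finset (Fin n)),
    MeasurableSet {p : (Fin m → ℝ) × Matrix (Fin m) (Fin n) ℝ | toFun p.1 p.2 k = t}

/-- The law of the noise vector: i.i.d. standard Gaussian entries. -/
def noise (m : ℕ) : Measure (Fin m → ℝ) :=
  Measure.pi fun _ => gaussianReal 0 1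

/-- The probability, over the sampling matrix `A` and the independent noise `W`, that the estimate
computed from `Y = A x + W` has distortion larger than `α`. -/
def errorProb {m n : ℕ} (M : SamplingMatrix m n) (e : Estimator m n) (α : ℝ) (x : Fin n → ℝ) :
    ENNReal :=
  (M.law.prod (noise m))
    {p | α < distortion (pattern x)
      (e.toFun (p.1.mulVec x + p.2) p.1 (pattern x).card)}

/-- A vector source: a set of sequences `(xⁿ)` with `xⁿ ∈ ℝⁿ`. -/
abbrev VectorSource : Type := Set ((n : ℕ) → Fin n → ℝ)

/-- The pair `(ρ, α)` is achievable for the source: there are `⌈ρ n⌉ × n` sampling matrices and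
estimators, one for each `n`, whose error probability tends to zero for every sequence of the
source. -/
def Achievable (X : VectorSource) (ρ α : ℝ) : Prop :=
  ∃ (M : (n : ℕ) → SamplingMatrix ⌈ρ * n⌉₊ n) (e : (n : ℕ) → Estimator ⌈ρ * n⌉₊ n),
    ∀ x ∈ X, Tendsto (fun n => errorProb (M n) (e n) α (x n)) atTop (𝓝 0)

/-- The sampling rate distortion function: the infimum of the achievable rates `ρ ≥ 0`, equal to
`⊤` if no finite rate is achievable. -/
def rateDistortion (X : VectorSource) (α : ℝ) : EReal :=
  sInf {r : EReal | ∃ ρ : ℝ, 0 ≤ ρ ∧ Achievable X ρ α ∧ r = (ρ : EReal)}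

/-- The empirical distribution function of the nonzero entries of `x`. -/
def empiricalCDF {n : ℕ} (x : Fin n → ℝ) (t : ℝ) : ℝ :=
  (((pattern x).filter fun i => x i ≤ t).card : ℝ) / ((pattern x).card : ℝ)

/-- The source `X(Ω, F)`: sequences with sparsity `⌊Ω n⌋` for which the empirical distribution
function of the nonzero entries converges uniformly to the distribution function of `F`. -/
def source (Ω : ℝ) (F : Measure ℝ) : VectorSource :=
  {x | (∀ n : ℕ, (pattern (x n)).card = ⌊Ω * n⌋₊) ∧
    TendstoUniformly (fun (n : ℕ) (t : ℝ) => empiricalCDF (x n) t) (fun t => cdf F t) atTop}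

/-- The covering rate `R(Ω, α)` of sparsity patterns, in nats per dimension. -/
def R (Ω α : ℝ) : ℝ :=
  if α < 1 - Ω then
    Real.binEntropy Ω - Ω * Real.binEntropy α
      - (1 - Ω) * Real.binEntropy (Ω * α / (1 - Ω))
  else 0

/-- The variance `V(Ω, F) = Ω (1 - Ω) μ_F² + Ω σ_F²` of the source. -/
def V (Ω : ℝ) (F : Measure ℝ) : ℝ :=
  Ω * (1 - Ω) * (∫ t, t ∂F) ^ 2 + Ω * variance id F

end SparsityPattern

end

noncomputable section

namespace SparsityPattern

/-! The proof is a converse of Fano type, with a change of measure in place of mutual information. A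
sample path of i.i.d. draws from `F` almost surely is nonzero, satisfies the law of large numbers
for its first two moments, and has uniformly convergent empirical distribution functions. Its first
`⌊Ω n⌋` terms, padded with zeros and rearranged arbitrarily for each `n`, form a sequence of the
source. Choosing the worst rearrangement for each `n` shows that the error probability tends to zero
uniformly over all rearrangements, so it suffices to bound the average success over a uniformly
random permutation.

The pattern is then a uniform set of size `⌊Ω n⌋`, and a guess made without data is within
distortion `α` with probability at most about `exp (-n R)` (`exists_covering_exponent`: a Chernoff
bound for the number of close sets, divided by a binomial coefficient).

Given `A`, the contribution of the mean of `x` is a known shift and can be removed; let `z` be the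
centred vector. Compare the output law `N(A (z ∘ σ), I)` with the reference law `N(0, c I)`, which
ignores `σ`. By the Donsker–Varadhan inequality, success probability times `l` is at most the
divergence plus a logarithm of an exponential moment, which becomes `log 2` after averaging over `σ`
(`sum_measureReal_mul_le`). The mean of `‖A (z ∘ σ)‖²` over permutations is at most `K * tr (A Aᵀ)`,
with `K` the sample variance of `x`; averaging over `A` replaces the trace by `m`. With `c = 1 + K`
the divergence is at most `m / 2 * log (1 + K)` (`one_sub_mul_le_log`). Dividing by `n`, with `l ~ n
R`, `m ~ ρ n` and `K → V`, gives `R ≤ ρ / 2 * log (1 + V)`. -/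

/-! ### Glivenko–Cantelli and a typical sequence for `F` -/

/-- The lower quantile function of a probability measure on the real line. -/
def quantile (F : Measure ℝ) (u : ℝ) : ℝ := sInf {x | u ≤ cdf F x}

/-- Right continuity of the distribution function makes the infimum attained; `0 < u < 1` makes the
set nonempty and bounded below. -/
lemma quantile_le_iff (F : Measure ℝ) {u : ℝ} (h0 : 0 < u) (h1 : u < 1) (x : ℝ) :
    quantile F u ≤ x ↔ u ≤ cdf F x := by
  have hne : {x | u ≤ cdf F x}.Nonempty := by
    obtain ⟨y, hy⟩ := ((tendsto_cdf_atTop F).eventually (lt_mem_nhds h1)).exists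
    exact ⟨y, hy.le⟩
  have hbdd : BddBelow {x | u ≤ cdf F x} := by
    obtain ⟨y, hy⟩ := ((tendsto_cdf_atBot F).eventually (gt_mem_nhds h0)).exists
    refine ⟨y, fun z hz => ?_⟩
    by_contra! hlt
    exact absurd (lt_of_le_of_lt (le_trans hz (monotone_cdf F hlt.le)) hy) (lt_irrefl u)
  constructor
  · intro hx
    have hq : u ≤ cdf F (quantile F u) := by
      have hcont : Tendsto (cdf F) (𝓝[>] (quantile F u)) (𝓝 (cdf F (quantile F u))) :=
        ((cdf F).right_continuous (quantile F u)).mono_left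
          (nhdsWithin_mono _ Set.Ioi_subset_Ici_self)
      refine ge_of_tendsto hcont ?_
      filter_upwards [self_mem_nhdsWithin] with y hy
      obtain ⟨z, hz, hzy⟩ := exists_lt_of_csInf_lt hne hy
      exact le_trans hz (monotone_cdf F hzy.le)
    exact hq.trans (monotone_cdf F hx)
  · exact fun hx => csInf_le hbdd hx

/-- The mass of the open half-line is the left limit of the distribution function, which stays below
`u` to the left of the quantile. An atom at the quantile is thus excluded, which is what the upper
half of the Glivenko–Cantelli argument needs. -/
lemma measureReal_Iio_quantile_le (F : Measure ℝ) [IsProbabilityMeasure F] {u : ℝ}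
    (h0 : 0 < u) (h1 : u < 1) : F.real (Set.Iio (quantile F u)) ≤ u := by
  have h := (cdf F).measure_Iio (tendsto_cdf_atBot F) (quantile F u)
  rw [measure_cdf] at h
  rw [Measure.real, h, sub_zero]
  refine ENNReal.toReal_le_of_le_ofReal h0.le (ENNReal.ofReal_le_ofReal ?_)
  refine le_of_tendsto ((monotone_cdf F).tendsto_leftLim (quantile F u)) ?_
  filter_upwards [self_mem_nhdsWithin] with y hy
  by_contra! hlt
  exact absurd ((quantile_le_iff F h0 h1 y).2 hlt.le) (not_le.2 hy)

/-- The deterministic part of the Glivenko–Cantelli theorem: monotone functions that converge at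
the quantiles, from the right and from the left, converge uniformly to the distribution function. -/
lemma tendstoUniformly_cdf_of_quantiles (F : Measure ℝ) [IsProbabilityMeasure F]
    (G G' : ℕ → ℝ → ℝ) (hmono : ∀ n, Monotone (G n)) (h0 : ∀ n t, 0 ≤ G n t)
    (h1 : ∀ n t, G n t ≤ 1) (hlt : ∀ n s t, s < t → G n s ≤ G' n t)
    (hG : ∀ u : ℚ, Tendsto (fun n => G n (quantile F u)) atTop (𝓝 (cdf F (quantile F u))))
    (hG' : ∀ u : ℚ, Tendsto (fun n => G' n (quantile F u)) atTop
      (𝓝 (F.real (Set.Iio (quantile F u))))) :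
    TendstoUniformly G (cdf F) atTop := by
  rw [Metric.tendstoUniformly_iff]
  intro ε hε
  obtain ⟨N, hN⟩ := exists_nat_gt (2 / ε)
  have hNpos : (0 : ℝ) < N := lt_trans (by positivity) hN
  have hNε : 1 / (N : ℝ) < ε / 2 := by
    rw [div_lt_iff₀ hNpos]; rw [div_lt_iff₀ hε] at hN; linarith
  have key : ∀ᶠ n in atTop, ∀ j ∈ Finset.range N,
      cdf F (quantile F ((j / N : ℚ) : ℝ)) - ε / 2 < G n (quantile F ((j / N : ℚ) : ℝ)) ∧
      G' n (quantile F ((j / N : ℚ) : ℝ)) <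
        F.real (Set.Iio (quantile F ((j / N : ℚ) : ℝ))) + ε / 2 := by
    rw [Filter.eventually_all_finset]
    intro j _
    exact ((hG (j / N)).eventually (lt_mem_nhds (by linarith))).and
      ((hG' (j / N)).eventually (gt_mem_nhds (by linarith)))
  filter_upwards [key] with n hn t
  have hjq : ∀ j : ℕ, (((j / N : ℚ) : ℝ)) = (j : ℝ) / N := fun j => by push_cast; rfl
  have hc0 := cdf_nonneg F t
  have hc1 := cdf_le_one F t
  -- The quantiles of levels `j / N` and `(j + 1) / N` enclose `t`; the grid costs `1 / N < ε / 2`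
  -- and convergence at the quantiles costs another `ε / 2`.
  set j := ⌊N * cdf F t⌋₊ with hj
  have hj1 : (j : ℝ) ≤ N * cdf F t := Nat.floor_le (by positivity)
  have hj2 : N * cdf F t < j + 1 := Nat.lt_floor_add_one _
  have hlow : cdf F t - ε < G n t := by
    rcases Nat.eq_zero_or_pos j with hj0 | hjpos
    · rw [hj0] at hj2
      have : cdf F t < 1 / N := by
        rw [lt_div_iff₀ hNpos]; push_cast at hj2; linarith
      linarith [h0 n t]
    · rcases lt_or_ge j N with hjN | hjN
      · have hjp : (0 : ℝ) < j := by exact_mod_cast hjpos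
        have hjl : (j : ℝ) / N < 1 := by rw [div_lt_one hNpos]; exact_mod_cast hjN
        have hle := (quantile_le_iff F (div_pos hjp hNpos) hjl t).2
          (by rw [div_le_iff₀ hNpos]; linarith)
        have hq := (quantile_le_iff F (div_pos hjp hNpos) hjl _).1 le_rfl
        have h3 := (hn j (Finset.mem_range.2 hjN)).1
        rw [hjq] at h3
        have h4 := hmono n hle
        have h5 : cdf F t < (j : ℝ) / N + 1 / N := by
          rw [← add_div, lt_div_iff₀ hNpos]; linarith
        linarith
      -- Here `cdf F t = 1`, and level `1` has no usable quantile, so level `(N - 1) / N` serves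
      -- instead. If `N = 1`, then `ε > 2` and there is nothing to prove.
      · have hN1 : 1 ≤ N := by exact_mod_cast Nat.cast_pos.1 hNpos
        rcases Nat.lt_or_ge 1 N with hN2 | hN2
        · have hk : N - 1 < N := by omega
          have hkc : ((N - 1 : ℕ) : ℝ) = N - 1 := by push_cast [hN1]; ring
          have hN2' : (1 : ℝ) < N := by exact_mod_cast hN2
          have hu0 : (0 : ℝ) < (N - 1 : ℝ) / N := div_pos (by linarith) hNpos
          have hu1 : (N - 1 : ℝ) / N < 1 := by rw [div_lt_one hNpos]; linarith
          have hjN' : (N : ℝ) ≤ j := by exact_mod_cast hjN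
          have hle := (quantile_le_iff F hu0 hu1 t).2
            (by rw [div_le_iff₀ hNpos]; linarith)
          have hq := (quantile_le_iff F hu0 hu1 _).1 le_rfl
          have h3 := (hn (N - 1) (Finset.mem_range.2 hk)).1
          rw [hjq, hkc] at h3
          have h4 := hmono n hle
          have h5 : (N - 1 : ℝ) / N = 1 - 1 / N := by field_simp
          linarith
        · have : N = 1 := by omega
          rw [this] at hNε
          have := h0 n t
          push_cast at hNε
          linarith
  have hupp : G n t < cdf F t + ε := by
    rcases lt_or_ge (j + 1) N with hjN | hjN
    · have hjp : (0 : ℝ) < (j : ℝ) + 1 := by positivity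
      have hjl : ((j : ℝ) + 1) / N < 1 := by rw [div_lt_one hNpos]; exact_mod_cast hjN
      have hlt' : t < quantile F (((j : ℝ) + 1) / N) := by
        rw [← not_le, quantile_le_iff F (div_pos hjp hNpos) hjl, not_le, lt_div_iff₀ hNpos]
        linarith
      have hq := measureReal_Iio_quantile_le F (div_pos hjp hNpos) hjl
      have h3 := (hn (j + 1) (Finset.mem_range.2 hjN)).2
      rw [hjq] at h3
      push_cast at h3
      have h4 := hlt n _ _ hlt'
      have h5 : ((j : ℝ) + 1) / N ≤ cdf F t + 1 / N := by
        rw [add_div]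
        have : (j : ℝ) / N ≤ cdf F t := by rw [div_le_iff₀ hNpos]; linarith
        linarith
      linarith
    · have : 1 - 1 / (N : ℝ) ≤ cdf F t := by
        have h6 : (N : ℝ) ≤ j + 1 := by exact_mod_cast hjN
        have h7 : 1 - 1 / (N : ℝ) = (N - 1) / N := by field_simp
        rw [h7, div_le_iff₀ hNpos]; linarith
      linarith [h1 n t]
  rw [Real.dist_eq, abs_lt]
  constructor <;> linarith

lemma ae_tendsto_average (F : Measure ℝ) [IsProbabilityMeasure F] {g : ℝ → ℝ}
    (hg : Measurable g) (hint : Integrable g F) :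
    ∀ᵐ ω ∂(Measure.infinitePi fun _ : ℕ => F),
      Tendsto (fun n : ℕ => (∑ i ∈ Finset.range n, g (ω i)) / n) atTop (𝓝 (∫ t, g t ∂F)) := by
  have hmp : ∀ i : ℕ, MeasurePreserving (fun ω : ℕ → ℝ => ω i)
      (Measure.infinitePi fun _ : ℕ => F) F :=
    fun i => measurePreserving_eval_infinitePi (fun _ : ℕ => F) i
  have hind : iIndepFun (fun (i : ℕ) (ω : ℕ → ℝ) => g (ω i))
      (Measure.infinitePi fun _ : ℕ => F) :=
    iIndepFun_infinitePi (X := fun _ x => g x) (fun _ => hg)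
  have h := strong_law_ae_real (fun (i : ℕ) (ω : ℕ → ℝ) => g (ω i))
    (μ := Measure.infinitePi fun _ : ℕ => F)
    ((hmp 0).integrable_comp_of_integrable hint)
    (fun i j hij => hind.indepFun hij)
    (fun i => ((IdentDistrib.mk (hmp i).measurable.aemeasurable (hmp 0).measurable.aemeasurable
      (by rw [(hmp i).map_eq, (hmp 0).map_eq])).comp hg))
  have he : ∫ ω, g (ω 0) ∂(Measure.infinitePi fun _ : ℕ => F) = ∫ t, g t ∂F :=
    (hmp 0).hasLaw.integral_comp hg.aestronglyMeasurable
  rw [he] at h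
  exact h

lemma ae_tendsto_frequency (F : Measure ℝ) [IsProbabilityMeasure F] {s : Set ℝ}
    (hs : MeasurableSet s) [DecidablePred (· ∈ s)] :
    ∀ᵐ ω ∂(Measure.infinitePi fun _ : ℕ => F),
      Tendsto (fun n : ℕ => (((Finset.range n).filter fun i => ω i ∈ s).card : ℝ) / n) atTop
        (𝓝 (F.real s)) := by
  have h := ae_tendsto_average F (g := s.indicator 1) (measurable_one.indicator hs)
    ((integrable_const (1 : ℝ)).indicator hs)
  rw [integral_indicator_one hs] at h
  filter_upwards [h] with ω hω
  convert hω using 3 with n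
  rw [Finset.card_filter]
  push_cast
  exact Finset.sum_congr rfl fun i _ => by simp [Set.indicator_apply]

/-- A sequence of nonzero reals that is empirically distributed like `F`: its empirical
distribution functions converge uniformly, and so do its first two moments. -/
lemma exists_empirical_sequence (F : Measure ℝ) [IsProbabilityMeasure F] (hF2 : MemLp id 2 F)
    (hF0 : F {0} = 0) :
    ∃ a : ℕ → ℝ, (∀ i, a i ≠ 0) ∧
      Tendsto (fun n : ℕ => (∑ i ∈ Finset.range n, a i) / n) atTop (𝓝 (∫ t, t ∂F)) ∧
      Tendsto (fun n : ℕ => (∑ i ∈ Finset.range n, a i ^ 2) / n) atTop (𝓝 (∫ t, t ^ 2 ∂F)) ∧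
      TendstoUniformly
        (fun (n : ℕ) (t : ℝ) => (((Finset.range n).filter fun i => a i ≤ t).card : ℝ) / n)
        (fun t => cdf F t) atTop := by
  have hnz : ∀ᵐ ω ∂(Measure.infinitePi fun _ : ℕ => F), ∀ i : ℕ, ω i ≠ 0 := by
    rw [ae_all_iff]
    intro i
    have hmp := measurePreserving_eval_infinitePi (fun _ : ℕ => F) i
    have : ∀ᵐ t ∂F, t ≠ 0 := by rw [ae_iff]; simpa using hF0
    exact hmp.quasiMeasurePreserving.ae this
  have hint1 : Integrable (fun t : ℝ => t) F := hF2.integrable (by norm_num)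
  have hint2 : Integrable (fun t : ℝ => t ^ 2) F := hF2.integrable_sq
  -- Rational levels suffice, so only countably many null sets are discarded.
  have hc : ∀ᵐ ω ∂(Measure.infinitePi fun _ : ℕ => F), ∀ u : ℚ, Tendsto
      (fun n : ℕ => (((Finset.range n).filter fun i => ω i ∈ Set.Iic (quantile F u)).card : ℝ) / n)
      atTop (𝓝 (F.real (Set.Iic (quantile F u)))) := by
    rw [ae_all_iff]
    exact fun u => ae_tendsto_frequency F measurableSet_Iic
  have hc' : ∀ᵐ ω ∂(Measure.infinitePi fun _ : ℕ => F), ∀ u : ℚ, Tendsto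
      (fun n : ℕ => (((Finset.range n).filter fun i => ω i ∈ Set.Iio (quantile F u)).card : ℝ) / n)
      atTop (𝓝 (F.real (Set.Iio (quantile F u)))) := by
    rw [ae_all_iff]
    exact fun u => ae_tendsto_frequency F measurableSet_Iio
  obtain ⟨a, ha0, ha1, ha2, ha3, ha4⟩ := (hnz.and ((ae_tendsto_average F measurable_id hint1).and
    ((ae_tendsto_average F (measurable_id.pow_const 2) hint2).and (hc.and hc')))).exists
  refine ⟨a, ha0, ha1, ha2, tendstoUniformly_cdf_of_quantiles F _
    (fun n t => (((Finset.range n).filter fun i => a i < t).card : ℝ) / n) ?_ ?_ ?_ ?_ ?_ ha4⟩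
  · intro n s t hst
    dsimp only
    gcongr with i
  · intro n t; positivity
  · intro n t
    refine div_le_one_of_le₀ ?_ (by positivity)
    exact_mod_cast (Finset.card_filter_le _ _).trans (Finset.card_range n).le
  · intro n s t hst
    gcongr with i
  · intro u
    rw [cdf_eq_real]
    exact ha3 u

/-! ### Counting patterns close to a fixed one -/

/-- The sum factors over indices: an index of `t` contributes `1` if chosen and `u` if not, any
other index `v` if chosen and `1` if not. -/
lemma sum_pow_card_sdiff_mul_pow_card_sdiff {n : ℕ} (t : Finset (Fin n)) (u v : ℝ) :
    ∑ s : Finset (Fin n), u ^ (t \ s).card * v ^ (s \ t).card =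
      (1 + u) ^ t.card * (1 + v) ^ (n - t.card) := by
  have h := Finset.prod_add (fun j => if j ∈ t then (1 : ℝ) else v)
    (fun j => if j ∈ t then u else 1) (Finset.univ : Finset (Fin n))
  have hl : ∏ j : Fin n, ((if j ∈ t then (1 : ℝ) else v) + (if j ∈ t then u else 1)) =
      (1 + u) ^ t.card * (1 + v) ^ (n - t.card) := by
    have : ∀ j : Fin n, ((if j ∈ t then (1 : ℝ) else v) + (if j ∈ t then u else 1)) =
        if j ∈ t then 1 + u else 1 + v := by
      intro j; split_ifs <;> ring
    rw [Finset.prod_congr rfl fun j _ => this j, Finset.prod_ite, Finset.prod_const,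
      Finset.prod_const]
    congr 2
    · simp
    · rw [← Finset.compl_filter, Finset.card_compl]; simp
  rw [← hl, h, Finset.powerset_univ]
  refine Finset.sum_congr rfl fun s _ => ?_
  rw [Finset.prod_ite, Finset.prod_ite]
  simp only [Finset.prod_const, one_pow, one_mul, mul_one]
  rw [mul_comm]
  congr 2
  · congr 1; ext j; simp
  · congr 1; ext j; simp [and_comm]

/-- A Chernoff bound for the number of sets `s` of the same size as `t` that miss few elements of
`t`. -/
lemma card_filter_sdiff_le {n : ℕ} (t : Finset (Fin n)) {u v γ : ℝ} (hu : 0 < u) (hv : 0 < v)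
    (huv : u * v ≤ 1) :
    ((Finset.univ.filter fun s : Finset (Fin n) =>
      s.card = t.card ∧ ((t \ s).card : ℝ) ≤ γ).card : ℝ) ≤
      (1 + u) ^ t.card * (1 + v) ^ (n - t.card) * (u * v) ^ (-γ) := by
  have huv0 : 0 < u * v := mul_pos hu hv
  rw [← sum_pow_card_sdiff_mul_pow_card_sdiff, Finset.sum_mul, Finset.card_filter]
  push_cast
  refine Finset.sum_le_sum fun s _ => ?_
  split_ifs with h
  -- Equal sizes turn the weight into `(u * v) ^ |t \ s|`, which is at least `(u * v) ^ γ` because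
  -- `u * v ≤ 1`.
  · have hc : (s \ t).card = (t \ s).card := Finset.card_sdiff_comm h.1
    rw [hc, ← mul_pow, ← Real.rpow_natCast, ← Real.rpow_add huv0]
    exact Real.one_le_rpow_of_pos_of_le_one_of_nonpos huv0 huv (by linarith [h.2])
  · positivity

lemma log_factorial_le {n : ℕ} (hn : 1 ≤ n) :
    Real.log n.factorial ≤ n * Real.log n - n + 1 + Real.log n := by
  induction n, hn using Nat.le_induction with
  | base => simp
  | succ n hn ih =>
    have hn0 : (0 : ℝ) < n := by exact_mod_cast hn
    rw [Nat.factorial_succ, Nat.cast_mul, Real.log_mul (by positivity) (by positivity)]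
    have h := Real.log_le_sub_one_of_pos (x := n / (n + 1)) (by positivity)
    rw [Real.log_div (by positivity) (by positivity)] at h
    have h2 : ((n : ℝ) / (n + 1) - 1) * (n + 1) = -1 := by field_simp; ring
    have h3 := mul_le_mul_of_nonneg_right h (by positivity : (0 : ℝ) ≤ n + 1)
    push_cast
    nlinarith

lemma le_log_factorial {n : ℕ} (hn : 1 ≤ n) :
    n * Real.log n - n ≤ Real.log n.factorial := by
  have h := Stirling.le_log_factorial_stirling (n := n) (by omega)
  have h1 : 0 ≤ Real.log n := Real.log_natCast_nonneg n
  have h2 : 0 ≤ Real.log (2 * Real.pi) := Real.log_nonneg (by linarith [Real.pi_gt_three])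
  linarith

lemma le_log_choose {n k : ℕ} (hk : 1 ≤ k) (hkn : k < n) :
    n * Real.binEntropy (k / n) - 2 - 2 * Real.log n ≤ Real.log (n.choose k) := by
  have hf := Nat.choose_mul_factorial_mul_factorial hkn.le
  have hl := congrArg (fun N : ℕ => Real.log N) hf
  have hcp : (n.choose k : ℝ) ≠ 0 := by exact_mod_cast (Nat.choose_pos hkn.le).ne'
  simp only [Nat.cast_mul] at hl
  rw [Real.log_mul (by positivity) (by positivity), Real.log_mul hcp (by positivity)] at hl
  have h1 := le_log_factorial (n := n) (by omega)
  have h2 := log_factorial_le hk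
  have h3 := log_factorial_le (n := n - k) (by omega)
  have hk0 : (0 : ℝ) < k := by exact_mod_cast hk
  have hn0 : (0 : ℝ) < n := by exact_mod_cast (by omega : 0 < n)
  have hkn' : (k : ℝ) < n := by exact_mod_cast hkn
  rw [Nat.cast_sub hkn.le] at h3
  have h4 : Real.log k ≤ Real.log n := Real.log_le_log hk0 hkn'.le
  have h5 : Real.log ((n : ℝ) - k) ≤ Real.log n := Real.log_le_log (by linarith) (by linarith)
  have h6 : n * Real.binEntropy (k / n) =
      n * Real.log n - k * Real.log k - (n - k) * Real.log ((n : ℝ) - k) := by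
    have h7 : 1 - (k : ℝ) / n = (n - k) / n := by field_simp
    rw [Real.binEntropy_eq_negMulLog_add_negMulLog_one_sub, h7, Real.negMulLog, Real.negMulLog,
      Real.log_div hk0.ne' hn0.ne', Real.log_div (by linarith) hn0.ne']
    field_simp
    ring
  rw [h6]
  linarith

/-! ### Patterns under a random permutation -/

lemma mem_pattern {n : ℕ} (x : Fin n → ℝ) (i : Fin n) : i ∈ pattern x ↔ x i ≠ 0 := by
  simp [pattern]

lemma pattern_comp_perm {n : ℕ} (x : Fin n → ℝ) (σ : Equiv.Perm (Fin n)) :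
    pattern (x ∘ σ) = (pattern x).map (σ⁻¹ : Equiv.Perm (Fin n)).toEmbedding := by
  ext i
  rw [mem_pattern, Finset.mem_map_equiv, mem_pattern]
  rfl

lemma card_pattern_comp_perm {n : ℕ} (x : Fin n → ℝ) (σ : Equiv.Perm (Fin n)) :
    (pattern (x ∘ σ)).card = (pattern x).card := by
  rw [pattern_comp_perm, Finset.card_map]

lemma exists_perm_map_eq {n : ℕ} {s t : Finset (Fin n)} (h : s.card = t.card) :
    ∃ τ : Equiv.Perm (Fin n), s.map τ.toEmbedding = t := by
  obtain ⟨e⟩ : Nonempty (s ≃ t) := Fintype.card_eq.1 (by simpa using h)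
  refine ⟨e.extendSubtype, ?_⟩
  refine Finset.eq_of_subset_of_card_le ?_ (by rw [Finset.card_map, h])
  intro j hj
  obtain ⟨i, hi, rfl⟩ := Finset.mem_map.1 hj
  exact e.extendSubtype_mem i hi

/-- A uniformly random permutation carries a vector's sparsity pattern to a uniformly random set of
the same size. -/
lemma choose_mul_card_filter_pattern {n : ℕ} (x : Fin n → ℝ) (P : Finset (Fin n) → Prop)
    [DecidablePred P] :
    n.choose (pattern x).card *
        (Finset.univ.filter fun σ : Equiv.Perm (Fin n) => P (pattern (x ∘ σ))).card =
      n.factorial *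
        (Finset.univ.filter fun s : Finset (Fin n) => s.card = (pattern x).card ∧ P s).card := by
  set c : Finset (Fin n) → ℕ := fun s =>
    (Finset.univ.filter fun σ : Equiv.Perm (Fin n) => pattern (x ∘ σ) = s).card with hc
  have hcc : ∀ s, s.card = (pattern x).card → c s = c (pattern x) := by
    intro s hs
    obtain ⟨τ, hτ⟩ := exists_perm_map_eq hs
    -- Translation by a permutation carrying `pattern x` to `s` matches the two fibres, so all
    -- fibres have the same size.
    refine Finset.card_bij (fun σ _ => σ * τ⁻¹) ?_ ?_ ?_
    · intro σ hσ
      simp only [Finset.mem_filter, Finset.mem_univ, true_and] at hσ ⊢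
      rw [← hτ, ← hσ]
      exact pattern_comp_perm (x ∘ σ) τ⁻¹ |>.trans (by rw [inv_inv])
    · intro σ _ σ' _ h
      exact mul_right_cancel h
    · intro σ hσ
      refine ⟨σ * τ, ?_, by simp⟩
      simp only [Finset.mem_filter, Finset.mem_univ, true_and] at hσ ⊢
      refine (pattern_comp_perm (x ∘ σ) τ).trans ?_
      rw [hσ, ← hτ, Finset.map_map]
      ext i; simp
  have hfib : ∀ (Q : Finset (Fin n) → Prop) [DecidablePred Q],
      (Finset.univ.filter fun σ : Equiv.Perm (Fin n) => Q (pattern (x ∘ σ))).card =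
        (Finset.univ.filter fun s : Finset (Fin n) => s.card = (pattern x).card ∧ Q s).card *
          c (pattern x) := by
    intro Q _
    rw [Finset.card_eq_sum_card_fiberwise (f := fun σ : Equiv.Perm (Fin n) => pattern (x ∘ σ))
      (t := Finset.univ.filter fun s : Finset (Fin n) => s.card = (pattern x).card ∧ Q s)]
    · rw [← smul_eq_mul, ← Finset.sum_const]
      refine Finset.sum_congr rfl fun s hs => ?_
      simp only [Finset.mem_filter, Finset.mem_univ, true_and] at hs
      rw [← hcc s hs.1, hc, Finset.filter_filter]
      congr 1
      ext σ
      simp only [Finset.mem_filter, Finset.mem_univ, true_and]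
      exact ⟨fun h => h.2, fun h => ⟨h ▸ hs.2, h⟩⟩
    · intro σ hσ
      simp only [Finset.coe_filter, Finset.mem_univ, true_and, Set.mem_ofPred_eq] at hσ ⊢
      exact ⟨card_pattern_comp_perm x σ, hσ⟩
  have htot := hfib (fun _ => True)
  have h1 : (Finset.univ.filter fun s : Finset (Fin n) =>
      s.card = (pattern x).card ∧ True).card = n.choose (pattern x).card := by
    simp only [and_true]
    rw [Finset.univ_filter_card_eq, Finset.card_powersetCard, Finset.card_univ, Fintype.card_fin]
  have h2 : (Finset.univ.filter fun _ : Equiv.Perm (Fin n) => True).card = n.factorial := by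
    rw [Finset.filter_true, Finset.card_univ, Fintype.card_perm, Fintype.card_fin]
  rw [h1, h2] at htot
  rw [hfib P, htot]
  ring

lemma card_sdiff_le_of_distortion_le {n : ℕ} {s t : Finset (Fin n)} {α : ℝ}
    (h : s.card = t.card) (ht : 0 < t.card) (hd : distortion s t ≤ α) :
    ((t \ s).card : ℝ) ≤ α * t.card := by
  have h1 := Finset.card_sdiff_add_card_inter t s
  have h2 : ((t \ s).card : ℝ) + ((s ∩ t).card : ℝ) = t.card := by
    rw [Finset.inter_comm]; exact_mod_cast h1
  have ht' : (0 : ℝ) < t.card := by exact_mod_cast ht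
  rw [distortion, h, sub_le_iff_le_add] at hd
  have h3 := mul_le_mul_of_nonneg_right hd ht'.le
  rw [add_mul, div_mul_cancel₀ _ ht'.ne'] at h3
  linarith

lemma card_filter_perm_distortion_le {n : ℕ} (x : Fin n → ℝ) {t : Finset (Fin n)} {α B C : ℝ}
    (ht : t.card = (pattern x).card) (ht0 : 0 < t.card)
    (hB : ((Finset.univ.filter fun s : Finset (Fin n) =>
      s.card = t.card ∧ ((t \ s).card : ℝ) ≤ α * t.card).card : ℝ) ≤ Real.exp B)
    (hC : C ≤ Real.log (n.choose t.card)) :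
    ((Finset.univ.filter fun σ : Equiv.Perm (Fin n) =>
      distortion (pattern (x ∘ σ)) t ≤ α).card : ℝ) ≤ Real.exp (B - C) * n.factorial := by
  have h := choose_mul_card_filter_pattern x (fun s => distortion s t ≤ α)
  rw [← ht] at h
  have htn : t.card ≤ n := (Finset.card_le_univ t).trans (Fintype.card_fin n).le
  have hcp : (0 : ℝ) < n.choose t.card := by exact_mod_cast Nat.choose_pos htn
  have hC' : Real.exp C ≤ n.choose t.card := by rwa [← Real.le_log_iff_exp_le hcp]
  have hle : ((Finset.univ.filter fun s : Finset (Fin n) =>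
      s.card = t.card ∧ distortion s t ≤ α).card : ℝ) ≤ Real.exp B := by
    refine le_trans ?_ hB
    refine Nat.cast_le.2 (Finset.card_le_card (Finset.monotone_filter_right _ fun s _ hs => ?_))
    exact ⟨hs.1, card_sdiff_le_of_distortion_le hs.1 ht0 hs.2⟩
  have h' : (n.choose t.card : ℝ) * ((Finset.univ.filter fun σ : Equiv.Perm (Fin n) =>
      distortion (pattern (x ∘ σ)) t ≤ α).card : ℝ) = n.factorial *
      ((Finset.univ.filter fun s : Finset (Fin n) =>
        s.card = t.card ∧ distortion s t ≤ α).card : ℝ) := by exact_mod_cast h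
  rw [Real.exp_sub, div_mul_eq_mul_div, le_div_iff₀ (Real.exp_pos C)]
  calc _ ≤ ((Finset.univ.filter fun σ : Equiv.Perm (Fin n) =>
      distortion (pattern (x ∘ σ)) t ≤ α).card : ℝ) * n.choose t.card := by gcongr
    _ = _ := by rw [mul_comm, h', mul_comm]
    _ ≤ _ := by gcongr

/-! ### The covering exponent -/

lemma tendsto_floor_mul_div {Ω : ℝ} (h : 0 ≤ Ω) :
    Tendsto (fun n : ℕ => (⌊Ω * n⌋₊ : ℝ) / n) atTop (𝓝 Ω) :=
  (tendsto_nat_floor_mul_div_atTop h).comp tendsto_natCast_atTop_atTop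

lemma tendsto_floor_mul_atTop {Ω : ℝ} (h : 0 < Ω) :
    Tendsto (fun n : ℕ => ⌊Ω * n⌋₊) atTop atTop :=
  tendsto_nat_floor_atTop.comp (tendsto_natCast_atTop_atTop.const_mul_atTop h)

lemma tendsto_entropy_rate {Ω : ℝ} (h : 0 ≤ Ω) :
    Tendsto (fun n : ℕ => ((n : ℝ) * Real.binEntropy ((⌊Ω * n⌋₊ : ℝ) / n) - 2 - 2 * Real.log n) / n)
      atTop (𝓝 (Real.binEntropy Ω)) := by
  have h1 := (Real.binEntropy_continuous.tendsto Ω).comp (tendsto_floor_mul_div h)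
  have h2 : Tendsto (fun n : ℕ => Real.log n / n) atTop (𝓝 0) :=
    (Real.isLittleO_log_id_atTop.tendsto_div_nhds_zero).comp tendsto_natCast_atTop_atTop
  have h3 : Tendsto (fun n : ℕ => (2 : ℝ) / n) atTop (𝓝 0) := tendsto_const_div_atTop_nhds_zero_nat 2
  have h4 := (h1.sub h3).sub (h2.const_mul 2)
  simp only [mul_zero, sub_zero] at h4
  refine h4.congr' ?_
  filter_upwards [eventually_gt_atTop 0] with n hn
  have : (n : ℝ) ≠ 0 := by positivity
  simp only [Function.comp]
  field_simp

/-- The exponential decay rate of the probability that a uniformly random sparsity pattern is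
within distortion `α` of a fixed one. -/
lemma exists_covering_exponent {Ω α : ℝ} (hΩ0 : 0 < Ω) (hΩ : Ω ≤ 1 / 2) (hα0 : 0 ≤ α)
    (hα : α < 1 - Ω) :
    ∃ r : ℕ → ℝ, Tendsto r atTop (𝓝 (R Ω α)) ∧ ∀ᶠ n : ℕ in atTop, ∀ (x : Fin n → ℝ)
      (t : Finset (Fin n)), (pattern x).card = ⌊Ω * n⌋₊ → t.card = ⌊Ω * n⌋₊ →
      ((Finset.univ.filter fun σ : Equiv.Perm (Fin n) =>
        distortion (pattern (x ∘ σ)) t ≤ α).card : ℝ) ≤ Real.exp (-(n * r n)) * n.factorial := by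
  suffices hB : ∃ B : ℕ → ℝ, Tendsto (fun n : ℕ => B n / n) atTop
      (𝓝 (Ω * Real.binEntropy α + (1 - Ω) * Real.binEntropy (Ω * α / (1 - Ω)))) ∧
      ∀ (n : ℕ) (t : Finset (Fin n)), t.card = ⌊Ω * n⌋₊ →
      ((Finset.univ.filter fun s : Finset (Fin n) =>
        s.card = t.card ∧ ((t \ s).card : ℝ) ≤ α * t.card).card : ℝ) ≤ Real.exp (B n) by
    obtain ⟨B, hB, hBle⟩ := hB
    refine ⟨fun n => ((n : ℝ) * Real.binEntropy ((⌊Ω * n⌋₊ : ℝ) / n) - 2 - 2 * Real.log n) / n -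
      B n / n, ?_, ?_⟩
    · have := (tendsto_entropy_rate hΩ0.le).sub hB
      convert this using 2
      rw [R, if_pos hα]; ring
    · filter_upwards [(tendsto_floor_mul_atTop hΩ0).eventually_ge_atTop 1,
        eventually_gt_atTop 0] with n hk hn x t hx ht
      have hn0 : (0 : ℝ) < n := by exact_mod_cast hn
      have hkn : ⌊Ω * n⌋₊ < n := by
        rw [Nat.floor_lt (by positivity)]
        nlinarith
      have hch := le_log_choose hk hkn
      rw [← ht] at hch
      refine (card_filter_perm_distortion_le x (ht.trans hx.symm) (by omega) (hBle n t ht)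
        hch).trans (le_of_eq ?_)
      congr 2
      rw [ht]
      field_simp
      ring
  rcases hα0.eq_or_lt with rfl | hαpos
  -- At `α = 0` the Chernoff parameters would vanish, but only `t` itself is counted.
  · refine ⟨fun _ => 0, by simp, fun n t _ => ?_⟩
    rw [Real.exp_zero]
    norm_cast
    rw [Finset.card_le_one]
    have hst : ∀ s ∈ Finset.univ.filter fun s : Finset (Fin n) =>
        s.card = t.card ∧ ((t \ s).card : ℝ) ≤ 0 * t.card, s = t := by
      intro s hs
      simp only [Finset.mem_filter, Finset.mem_univ, true_and, zero_mul] at hs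
      have h0 : (t \ s).card = 0 := by
        have := hs.2; norm_cast at this; omega
      rw [Finset.card_eq_zero, Finset.sdiff_eq_empty_iff_subset] at h0
      exact (Finset.eq_of_subset_of_card_le h0 hs.1.le).symm
    intro s hs s' hs'
    rw [hst s (by simpa using hs), hst s' (by simpa using hs')]
  · set b := Ω * α / (1 - Ω) with hb
    have h1Ω : 0 < 1 - Ω := by linarith
    have hb0 : 0 < b := by positivity
    have hbα : b + α < 1 := by
      rw [hb, div_add' _ _ _ h1Ω.ne', div_lt_one h1Ω]; linarith
    have hα1 : 0 < 1 - α := by linarith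
    have hb1 : 0 < 1 - b := by linarith
    -- The parameters are the odds of `α`, the fraction of `t` that is missed, and of `b`, the
    -- fraction of the complement then taken in, since `Ω * α = (1 - Ω) * b`. The condition `u * v ≤
    -- 1` amounts to `α + b ≤ 1`, which is where `α < 1 - Ω` enters.
    set u := α / (1 - α) with hu
    set v := b / (1 - b) with hv
    have hu0 : 0 < u := by positivity
    have hv0 : 0 < v := by positivity
    have huv : u * v ≤ 1 := by
      rw [hu, hv, div_mul_div_comm, div_le_one (by positivity)]; nlinarith
    refine ⟨fun n => (⌊Ω * n⌋₊ : ℝ) * Real.log (1 + u) + ((n : ℝ) - ⌊Ω * n⌋₊) * Real.log (1 + v) -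
      α * ⌊Ω * n⌋₊ * Real.log (u * v), ?_, ?_⟩
    · have h1 := tendsto_floor_mul_div hΩ0.le
      have h2 := ((h1.mul_const (Real.log (1 + u))).add
        ((h1.const_sub 1).mul_const (Real.log (1 + v)))).sub
        ((h1.const_mul α).mul_const (Real.log (u * v)))
      have hlim : Ω * Real.binEntropy α + (1 - Ω) * Real.binEntropy b =
          Ω * Real.log (1 + u) + (1 - Ω) * Real.log (1 + v) - α * Ω * Real.log (u * v) := by
        have e1 : 1 + u = (1 - α)⁻¹ := by rw [hu]; field_simp; ring
        have e2 : 1 + v = (1 - b)⁻¹ := by rw [hv]; field_simp; ring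
        rw [e1, e2, Real.log_mul hu0.ne' hv0.ne', hu, hv, Real.log_div hαpos.ne' hα1.ne',
          Real.log_div hb0.ne' hb1.ne', Real.binEntropy_eq_negMulLog_add_negMulLog_one_sub,
          Real.binEntropy_eq_negMulLog_add_negMulLog_one_sub, Real.log_inv, Real.log_inv]
        simp only [Real.negMulLog]
        have e3 : (1 - Ω) * b = Ω * α := by rw [hb]; field_simp
        linear_combination (-Real.log b + Real.log (1 - b)) * e3
      rw [hlim]
      refine h2.congr' ?_
      filter_upwards [eventually_gt_atTop 0] with n hn
      have : (n : ℝ) ≠ 0 := by positivity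
      field_simp
    · intro n t ht
      refine (card_filter_sdiff_le t hu0 hv0 huv).trans (le_of_eq ?_)
      have htn : t.card ≤ n := (Finset.card_le_univ t).trans (Fintype.card_fin n).le
      dsimp only
      rw [← ht, Real.exp_sub, Real.exp_add, ← Nat.cast_sub htn, mul_comm (t.card : ℝ),
        mul_comm ((n - t.card : ℕ) : ℝ), Real.exp_mul, Real.exp_mul, Real.exp_log (by positivity),
        Real.exp_log (by positivity), Real.rpow_natCast, Real.rpow_natCast,
        Real.rpow_def_of_pos (by positivity), div_eq_mul_inv, ← Real.exp_neg]
      congr 2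
      ring

/-! ### Second moments over permutations -/

/-- Second moments of a uniformly random rearrangement of a centred vector. -/
lemma sum_perm_mul {n : ℕ} (hn : 2 ≤ n) (z : Fin n → ℝ) (hz : ∑ i, z i = 0) (j l : Fin n) :
    ∑ σ : Equiv.Perm (Fin n), z (σ j) * z (σ l) =
      (n.factorial * (∑ i, z i ^ 2) / n) * ((if j = l then (n : ℝ) else 0) - 1) / (n - 1) := by
  set T : Fin n → Fin n → ℝ := fun j l => ∑ σ : Equiv.Perm (Fin n), z (σ j) * z (σ l) with hT
  -- By this invariance `T` takes one value on the diagonal and one off it. The diagonal sum is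
  -- known and each row sums to zero, which determines both values.
  have hinv : ∀ (τ : Equiv.Perm (Fin n)) (j l : Fin n), T (τ j) (τ l) = T j l := fun τ j l =>
    Fintype.sum_equiv (Equiv.mulRight τ) _ _ fun σ => rfl
  have hn0 : (0 : ℝ) < n := by positivity
  have hn1 : (0 : ℝ) < (n : ℝ) - 1 := by
    have : (2 : ℝ) ≤ n := by exact_mod_cast hn
    linarith
  have hdiag : ∀ j, n * T j j = n.factorial * ∑ i, z i ^ 2 := by
    intro j
    have h1 : ∀ i, T i i = T j j := fun i => by
      have := hinv (Equiv.swap j i) j j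
      rwa [Equiv.swap_apply_left] at this
    have h2 : ∑ i, T i i = n.factorial * ∑ i, z i ^ 2 := by
      rw [hT, Finset.sum_comm]
      have : ∀ σ : Equiv.Perm (Fin n), ∑ i, z (σ i) * z (σ i) = ∑ i, z i ^ 2 := fun σ => by
        rw [← Equiv.sum_comp σ (fun i => z i ^ 2)]
        exact Finset.sum_congr rfl fun i _ => (sq _).symm
      rw [Finset.sum_congr rfl fun σ _ => this σ, Finset.sum_const, Finset.card_univ,
        Fintype.card_perm, Fintype.card_fin, nsmul_eq_mul]
    rw [← h2, Finset.sum_congr rfl fun i _ => h1 i]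
    simp
  by_cases hjl : j = l
  · subst hjl
    rw [if_pos rfl, mul_div_assoc, div_self hn1.ne', mul_one, eq_div_iff hn0.ne', ← hdiag j]
    ring
  · have h3 : ∀ l', l' ≠ j → T j l' = T j l := fun l' hl' => by
      have := hinv (Equiv.swap l l') j l
      rwa [Equiv.swap_apply_left, Equiv.swap_apply_of_ne_of_ne hjl (Ne.symm hl')] at this
    have h4 : ∑ l', T j l' = 0 := by
      rw [hT, Finset.sum_comm]
      refine Finset.sum_eq_zero fun σ _ => ?_
      rw [← Finset.mul_sum, Equiv.sum_comp σ z, hz, mul_zero]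
    rw [← Finset.add_sum_erase _ _ (Finset.mem_univ j),
      Finset.sum_congr rfl fun l' hl' => h3 l' (Finset.ne_of_mem_erase hl'), Finset.sum_const,
      Finset.card_erase_of_mem (Finset.mem_univ j), Finset.card_univ, Fintype.card_fin,
      nsmul_eq_mul, Nat.cast_sub (by omega), Nat.cast_one] at h4
    rw [if_neg hjl, eq_div_iff hn1.ne', ← hdiag j]
    change T j l * (n - 1) = _
    field_simp
    linarith

/-- The second-moment matrix is a multiple of `n I - J`, with `J` the all-ones matrix; the bound
drops the term `-(∑ w j) ^ 2` coming from `J`. -/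
lemma sum_perm_inner_sq_le {n : ℕ} (hn : 2 ≤ n) (z w : Fin n → ℝ) (hz : ∑ i, z i = 0) :
    ∑ σ : Equiv.Perm (Fin n), (∑ j, w j * z (σ j)) ^ 2 ≤
      n.factorial * ((∑ i, z i ^ 2) / (n - 1)) * ∑ j, w j ^ 2 := by
  have hn0 : (0 : ℝ) < n := by positivity
  have hn1 : (0 : ℝ) < (n : ℝ) - 1 := by
    have : (2 : ℝ) ≤ n := by exact_mod_cast hn
    linarith
  set K : ℝ := n.factorial * (∑ i, z i ^ 2) / n / (n - 1) with hK
  have hK0 : 0 ≤ K := by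
    have : 0 ≤ ∑ i, z i ^ 2 := Finset.sum_nonneg fun i _ => sq_nonneg _
    positivity
  have h1 : ∑ σ : Equiv.Perm (Fin n), (∑ j, w j * z (σ j)) ^ 2 =
      ∑ j, ∑ l, w j * w l * ∑ σ : Equiv.Perm (Fin n), z (σ j) * z (σ l) := by
    simp_rw [sq, Finset.sum_mul_sum, Finset.mul_sum]
    rw [Finset.sum_comm]
    refine Finset.sum_congr rfl fun j _ => ?_
    rw [Finset.sum_comm]
    refine Finset.sum_congr rfl fun l _ => Finset.sum_congr rfl fun σ _ => ?_
    ring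
  have h2 : ∀ j l, w j * w l * ∑ σ : Equiv.Perm (Fin n), z (σ j) * z (σ l) =
      K * ((if j = l then n * (w j * w l) else 0) - w j * w l) := by
    intro j l
    rw [sum_perm_mul hn z hz, hK]
    split_ifs <;> ring
  have h3 : ∑ j, ∑ l, w j * w l = (∑ j, w j) ^ 2 := by rw [sq, Finset.sum_mul_sum]
  rw [h1]
  simp_rw [h2, ← Finset.mul_sum, Finset.sum_sub_distrib]
  rw [h3]
  simp only [Finset.sum_ite_eq, Finset.mem_univ, if_true, ← Finset.mul_sum]
  have h4 : n.factorial * ((∑ i, z i ^ 2) / (n - 1)) * ∑ j, w j ^ 2 =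
      K * (n * ∑ j, w j * w j) := by
    rw [hK]; simp_rw [sq]; field_simp
  rw [h4]
  exact mul_le_mul_of_nonneg_left (by linarith [sq_nonneg (∑ j, w j)]) hK0

lemma sum_perm_mulVec_sq_le {m n : ℕ} (hn : 2 ≤ n) (z : Fin n → ℝ) (hz : ∑ i, z i = 0)
    (A : Matrix (Fin m) (Fin n) ℝ) :
    ∑ σ : Equiv.Perm (Fin n), ∑ i, (A.mulVec (z ∘ σ) i) ^ 2 ≤
      n.factorial * ((∑ i, z i ^ 2) / (n - 1)) * (A * A.transpose).trace := by
  have htr : (A * A.transpose).trace = ∑ i, ∑ j, A i j ^ 2 := by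
    simp [Matrix.trace, Matrix.mul_apply, sq]
  rw [htr, Finset.mul_sum, Finset.sum_comm]
  exact Finset.sum_le_sum fun i _ => sum_perm_inner_sq_le hn z (A i) hz

/-! ### Change of measure between Gaussian laws -/

instance (m : ℕ) : IsProbabilityMeasure (noise m) := by unfold noise; infer_instance

lemma withDensity_pi {ι : Type*} [Fintype ι] {X : ι → Type*} [∀ i, MeasurableSpace (X i)]
    (μ : (i : ι) → Measure (X i)) [∀ i, IsProbabilityMeasure (μ i)]
    {f : (i : ι) → X i → ENNReal} (hf : ∀ i, Measurable (f i))
    [∀ i, SigmaFinite ((μ i).withDensity (f i))] :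
    (Measure.pi μ).withDensity (fun x => ∏ i, f i (x i)) =
      Measure.pi fun i => (μ i).withDensity (f i) := by
  refine (Measure.pi_eq fun s hs => ?_).symm
  rw [withDensity_apply _ (MeasurableSet.univ_pi hs), ← lintegral_indicator (MeasurableSet.univ_pi hs)]
  have h1 : ∀ x : (i : ι) → X i, (Set.univ.pi s).indicator (fun x => ∏ i, f i (x i)) x =
      ∏ i, (s i).indicator (f i) (x i) := by
    intro x
    by_cases hx : x ∈ Set.univ.pi s
    · rw [Set.indicator_of_mem hx]
      exact Finset.prod_congr rfl fun i _ => (Set.indicator_of_mem (hx i trivial) _).symm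
    · rw [Set.indicator_of_notMem hx]
      simp only [Set.mem_pi, Set.mem_univ, true_imp_iff, not_forall] at hx
      obtain ⟨i, hi⟩ := hx
      exact (Finset.prod_eq_zero (Finset.mem_univ i) (Set.indicator_of_notMem hi _)).symm
  have hind : iIndepFun (fun i (x : (i : ι) → X i) => (s i).indicator (f i) (x i))
      (Measure.pi μ) := iIndepFun_pi fun i => ((hf i).indicator (hs i)).aemeasurable
  rw [lintegral_congr h1, lintegral_prod_eq_prod_lintegral_of_indepFun _ _ hind
    fun i => ((hf i).indicator (hs i)).comp (measurable_pi_apply i)]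
  refine Finset.prod_congr rfl fun i _ => ?_
  rw [withDensity_apply _ (hs i), ← lintegral_indicator (hs i)]
  exact (measurePreserving_eval μ i).lintegral_comp ((hf i).indicator (hs i))

/-- The log-likelihood ratio, at the point `a + w`, of the Gaussian laws with mean `a` and identity
covariance, and with mean `0` and covariance `c` times the identity. -/
def logLikelihood {m : ℕ} (c : ℝ) (a w : Fin m → ℝ) : ℝ :=
  ∑ i, (Real.log c / 2 + (a i + w i) ^ 2 / (2 * c) - w i ^ 2 / 2)

lemma gaussianReal_withDensity {c : NNReal} (hc : c ≠ 0) (a : ℝ) :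
    (gaussianReal 0 1).withDensity (fun w => ENNReal.ofReal
      (Real.exp (-(Real.log c / 2 + (a + w) ^ 2 / (2 * c) - w ^ 2 / 2)))) =
      gaussianReal (-a) c := by
  have hc0 : (0 : ℝ) < c := by positivity
  rw [gaussianReal_of_var_ne_zero _ one_ne_zero, gaussianReal_of_var_ne_zero _ hc,
    ← withDensity_mul _ (measurable_gaussianPDF 0 1) (by fun_prop)]
  congr 1
  ext w
  rw [Pi.mul_apply, gaussianPDF, gaussianPDF, ← ENNReal.ofReal_mul (gaussianPDFReal_nonneg _ _ _)]
  congr 1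
  have hs : (√(2 * Real.pi * c))⁻¹ = (√(2 * Real.pi))⁻¹ * Real.exp (-(Real.log c / 2)) := by
    rw [Real.sqrt_mul (by positivity), mul_inv, Real.exp_neg]
    congr 2
    rw [Real.exp_half, Real.exp_log hc0]
  simp only [gaussianPDFReal]
  rw [hs, NNReal.coe_one, mul_one, mul_assoc, mul_assoc, ← Real.exp_add, ← Real.exp_add]
  congr 2
  ring

/-- The reference law is written as a reweighting of the noise followed by the shift by `a`. Every
signal point can thus be compared with the same reference law by integrals over the noise. -/
lemma noise_withDensity_map {m : ℕ} {c : NNReal} (hc : c ≠ 0) (a : Fin m → ℝ) :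
    ((noise m).withDensity fun w => ENNReal.ofReal (Real.exp (-logLikelihood c a w))).map
      (fun w => a + w) = Measure.pi fun _ : Fin m => gaussianReal 0 c := by
  have h1 : (fun w : Fin m → ℝ => ENNReal.ofReal (Real.exp (-logLikelihood c a w))) =
      fun w => ∏ i, ENNReal.ofReal
        (Real.exp (-(Real.log c / 2 + (a i + w i) ^ 2 / (2 * c) - w i ^ 2 / 2))) := by
    ext w
    rw [← ENNReal.ofReal_prod_of_nonneg fun i _ => (Real.exp_pos _).le, ← Real.exp_sum,
      Finset.sum_neg_distrib, logLikelihood]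
  have h2 := fun i : Fin m => gaussianReal_withDensity hc (a i)
  have hsf : ∀ i : Fin m, SigmaFinite ((gaussianReal 0 1).withDensity (fun w => ENNReal.ofReal
      (Real.exp (-(Real.log c / 2 + (a i + w) ^ 2 / (2 * c) - w ^ 2 / 2))))) := fun i => by
    rw [h2 i]; infer_instance
  rw [h1, noise, withDensity_pi (fun _ => gaussianReal 0 1) (f := fun i w => ENNReal.ofReal
      (Real.exp (-(Real.log c / 2 + (a i + w) ^ 2 / (2 * c) - w ^ 2 / 2)))) (fun i => by fun_prop)]
  simp_rw [h2]
  have h3 : ∀ i : Fin m, (gaussianReal (-a i) c).map (fun w => a i + w) = gaussianReal 0 c :=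
    fun i => by rw [gaussianReal_map_const_add]; simp
  have hsf' : ∀ i : Fin m, SigmaFinite ((gaussianReal (-a i) c).map (fun w => a i + w)) :=
    fun i => by rw [h3 i]; infer_instance
  have h4 := Measure.pi_map_pi (μ := fun i : Fin m => gaussianReal (-a i) c)
    (f := fun i w => a i + w) (fun i => by fun_prop)
  simp_rw [h3] at h4
  exact h4

lemma measurable_logLikelihood {m : ℕ} (c : ℝ) (a : Fin m → ℝ) :
    Measurable (logLikelihood c a) := by
  unfold logLikelihood; fun_prop

lemma integral_exp_neg_logLikelihood {m : ℕ} {c : NNReal} (hc : c ≠ 0) (a : Fin m → ℝ)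
    {g : (Fin m → ℝ) → ℝ} (hg : Measurable g) (hb : ∃ C, ∀ y, |g y| ≤ C) :
    Integrable (fun w => Real.exp (-logLikelihood c a w) * g (a + w)) (noise m) ∧
      ∫ w, Real.exp (-logLikelihood c a w) * g (a + w) ∂(noise m) =
        ∫ y, g y ∂(Measure.pi fun _ : Fin m => gaussianReal 0 c) := by
  have hmap := noise_withDensity_map hc a
  have hm : Measurable fun w : Fin m → ℝ => ENNReal.ofReal (Real.exp (-logLikelihood c a w)) :=
    (measurable_logLikelihood (c : ℝ) a).neg.exp.ennreal_ofReal
  have hadd : Measurable fun w : Fin m → ℝ => a + w := measurable_const_add a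
  obtain ⟨C, hC⟩ := hb
  have hint : Integrable g (Measure.pi fun _ : Fin m => gaussianReal 0 c) :=
    Integrable.of_bound hg.aestronglyMeasurable C (ae_of_all _ hC)
  have htr : ∀ w, (ENNReal.ofReal (Real.exp (-logLikelihood c a w))).toReal • g (a + w) =
      Real.exp (-logLikelihood c a w) * g (a + w) := fun w => by
    rw [ENNReal.toReal_ofReal (Real.exp_pos _).le, smul_eq_mul]
  constructor
  · rw [← hmap, integrable_map_measure hg.aestronglyMeasurable hadd.aemeasurable,
      integrable_withDensity_iff_integrable_smul' hm (ae_of_all _ fun _ => ENNReal.ofReal_lt_top)]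
      at hint
    exact hint.congr (ae_of_all _ htr)
  · rw [← hmap, integral_map hadd.aemeasurable hg.aestronglyMeasurable,
      integral_withDensity_eq_integral_toReal_smul hm (ae_of_all _ fun _ => ENNReal.ofReal_lt_top)]
    exact (integral_congr_ae (ae_of_all _ htr)).symm

lemma integral_sq_add_gaussianReal (a : ℝ) :
    Integrable (fun w => (a + w) ^ 2) (gaussianReal 0 1) ∧
      ∫ w, (a + w) ^ 2 ∂(gaussianReal 0 1) = a ^ 2 + 1 := by
  have h2 : MemLp (fun w : ℝ => w) 2 (gaussianReal 0 1) :=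
    memLp_id_gaussianReal' 2 (by norm_num)
  have i1 : Integrable (fun w : ℝ => w) (gaussianReal 0 1) := h2.integrable (by norm_num)
  have i2 : Integrable (fun w : ℝ => w ^ 2) (gaussianReal 0 1) := h2.integrable_sq
  have hv := variance_eq_sub h2
  rw [variance_fun_id_gaussianReal, integral_id_gaussianReal] at hv
  have hv' : ∫ w : ℝ, w ^ 2 ∂(gaussianReal 0 1) = 1 := by
    simpa using hv.symm
  have he : (fun w : ℝ => (a + w) ^ 2) = fun w => (a ^ 2 + 2 * a * w) + w ^ 2 := by
    ext w; ring
  have i3 : Integrable (fun w : ℝ => a ^ 2 + 2 * a * w) (gaussianReal 0 1) :=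
    (integrable_const _).add (i1.const_mul _)
  rw [he]
  refine ⟨i3.add i2, ?_⟩
  rw [integral_add i3 i2, integral_add (integrable_const _) (i1.const_mul _), integral_const_mul,
    integral_id_gaussianReal, hv']
  simp

lemma integral_logLikelihood {m : ℕ} (c : ℝ) (a : Fin m → ℝ) :
    Integrable (logLikelihood c a) (noise m) ∧
      ∫ w, logLikelihood c a w ∂(noise m) =
        m * (Real.log c / 2 + 1 / (2 * c) - 1 / 2) + (∑ i, a i ^ 2) / (2 * c) := by
  have hmp : ∀ i : Fin m, MeasurePreserving (fun w : Fin m → ℝ => w i) (noise m)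
      (gaussianReal 0 1) := fun i => measurePreserving_eval (fun _ => gaussianReal 0 1) i
  have hi : ∀ (i : Fin m) (b : ℝ), Integrable (fun w : Fin m → ℝ => (b + w i) ^ 2) (noise m) ∧
      ∫ w, (b + w i) ^ 2 ∂(noise m) = b ^ 2 + 1 := fun i b => by
    obtain ⟨h1, h2⟩ := integral_sq_add_gaussianReal b
    refine ⟨(hmp i).integrable_comp_of_integrable h1, ?_⟩
    rw [← h2]
    exact (hmp i).hasLaw.integral_comp h1.aestronglyMeasurable
  have hi0 : ∀ (i : Fin m), Integrable (fun w : Fin m → ℝ => w i ^ 2) (noise m) ∧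
      ∫ w, w i ^ 2 ∂(noise m) = 1 := fun i => by simpa using hi i 0
  have hsum : ∀ i : Fin m, Integrable (fun w : Fin m → ℝ =>
      Real.log c / 2 + (a i + w i) ^ 2 / (2 * c) - w i ^ 2 / 2) (noise m) := fun i =>
    ((integrable_const _).add ((hi i (a i)).1.div_const _)).sub ((hi0 i).1.div_const _)
  unfold logLikelihood
  refine ⟨integrable_finsetSum _ fun i _ => hsum i, ?_⟩
  rw [integral_finsetSum _ fun i _ => hsum i]
  have : ∀ i : Fin m, ∫ w, (Real.log c / 2 + (a i + w i) ^ 2 / (2 * c) - w i ^ 2 / 2) ∂(noise m) =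
      (Real.log c / 2 + 1 / (2 * c) - 1 / 2) + a i ^ 2 / (2 * c) := fun i => by
    have i3 : Integrable (fun w : Fin m → ℝ => Real.log c / 2 + (a i + w i) ^ 2 / (2 * c))
        (noise m) := (integrable_const _).add ((hi i (a i)).1.div_const _)
    rw [integral_sub i3 ((hi0 i).1.div_const _), integral_add (integrable_const _) ((hi i (a i)).1.div_const _),
      integral_const, integral_div, integral_div, (hi i (a i)).2, (hi0 i).2]
    simp
    ring
  rw [Finset.sum_congr rfl fun i _ => this i, Finset.sum_add_distrib, ← Finset.sum_div,
    Finset.sum_const, Finset.card_univ, Fintype.card_fin, nsmul_eq_mul]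

/-- This is Donsker–Varadhan for the function `l * 1_D`, with the logarithm replaced by its tangent
at `2`, namely `log x ≤ x / 2 - 1 + log 2`. The right-hand side is then linear in the reference
probability of `D` and can be summed over many regions. Nothing is lost at leading order, since the
average exponential moment will be at most `2`. -/
lemma measureReal_mul_le {m : ℕ} {c : NNReal} (hc : c ≠ 0) (a : Fin m → ℝ)
    {D : Set (Fin m → ℝ)} (hD : MeasurableSet D) (l : ℝ) :
    (noise m).real {w | a + w ∈ D} * l ≤
      m * (Real.log c / 2 + 1 / (2 * c) - 1 / 2) + (∑ i, a i ^ 2) / (2 * c) +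
        (1 + Real.exp l * (Measure.pi fun _ : Fin m => gaussianReal 0 c).real D) / 2 -
          1 + Real.log 2 := by
  have hpre : MeasurableSet {w : Fin m → ℝ | a + w ∈ D} := measurable_const_add a hD
  -- A majorant of `exp (l * 1_D)`, whose value off `D` is `1`.
  set g : (Fin m → ℝ) → ℝ := fun y => 1 + Real.exp l * D.indicator 1 y with hg
  have hgm : Measurable g := ((measurable_one.indicator hD).const_mul _).const_add _
  have hgb : ∃ C, ∀ y, |g y| ≤ C := by
    refine ⟨1 + Real.exp l, fun y => ?_⟩
    have := Real.exp_pos l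
    by_cases hy : y ∈ D
    · simp only [hg, Set.indicator_of_mem hy, Pi.one_apply, mul_one]
      rw [abs_of_pos (by positivity)]
    · simp only [hg, Set.indicator_of_notMem hy, mul_zero, add_zero, abs_one]
      linarith
  obtain ⟨hi1, he1⟩ := integral_exp_neg_logLikelihood hc a hgm hgb
  obtain ⟨hi2, he2⟩ := integral_logLikelihood (c : ℝ) a
  have hgi : ∫ y, g y ∂(Measure.pi fun _ : Fin m => gaussianReal 0 c) =
      1 + Real.exp l * (Measure.pi fun _ : Fin m => gaussianReal 0 c).real D := by
    have i3 : Integrable (D.indicator (1 : (Fin m → ℝ) → ℝ))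
        (Measure.pi fun _ : Fin m => gaussianReal 0 c) := (integrable_const (1 : ℝ)).indicator hD
    simp only [hg]
    rw [integral_add (integrable_const _) (i3.const_mul _), integral_const_mul,
      integral_indicator_one hD]
    simp
  have hpt : ∀ w, {w | a + w ∈ D}.indicator (1 : (Fin m → ℝ) → ℝ) w * l ≤
      (logLikelihood c a w + (Real.exp (-logLikelihood c a w) * g (a + w)) / 2) +
        (-1 + Real.log 2) := by
    intro w
    have hgpos : 0 < g (a + w) := by
      have : 0 ≤ D.indicator (1 : (Fin m → ℝ) → ℝ) (a + w) :=
        Set.indicator_nonneg (fun _ _ => zero_le_one) _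
      have := Real.exp_pos l
      simp only [hg]; positivity
    have hlog := Real.log_le_sub_one_of_pos
      (x := Real.exp (-logLikelihood c a w) * g (a + w) / 2)
      (by have := Real.exp_pos (-logLikelihood c a w); positivity)
    rw [Real.log_div (mul_pos (Real.exp_pos _) hgpos).ne' two_ne_zero,
      Real.log_mul (Real.exp_pos _).ne' hgpos.ne', Real.log_exp] at hlog
    have hgl : {w | a + w ∈ D}.indicator (1 : (Fin m → ℝ) → ℝ) w * l ≤ Real.log (g (a + w)) := by
      rw [Real.le_log_iff_exp_le hgpos]
      by_cases hw : a + w ∈ D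
      · rw [Set.indicator_of_mem (show w ∈ {w | a + w ∈ D} from hw)]
        simp only [hg, Set.indicator_of_mem hw, Pi.one_apply, one_mul, mul_one]
        linarith
      · rw [Set.indicator_of_notMem (show w ∉ {w | a + w ∈ D} from hw)]
        simp [hg, Set.indicator_of_notMem hw]
    linarith
  have hi3 : Integrable (fun w => logLikelihood c a w +
      (Real.exp (-logLikelihood c a w) * g (a + w)) / 2) (noise m) := hi2.add (hi1.div_const 2)
  have hi4 : Integrable ({w | a + w ∈ D}.indicator (1 : (Fin m → ℝ) → ℝ)) (noise m) :=
    (integrable_const (1 : ℝ)).indicator hpre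
  have hmono := integral_mono (μ := noise m) (hi4.mul_const l)
    (hi3.add (integrable_const (-1 + Real.log 2))) hpt
  have hL : ∫ w, {w | a + w ∈ D}.indicator (1 : (Fin m → ℝ) → ℝ) w * l ∂(noise m) =
      (noise m).real {w | a + w ∈ D} * l := by
    rw [integral_mul_const, integral_indicator_one hpre]
  have hR : ∫ w, ((logLikelihood c a w + (Real.exp (-logLikelihood c a w) * g (a + w)) / 2) +
        (-1 + Real.log 2)) ∂(noise m) =
      (m * (Real.log c / 2 + 1 / (2 * c) - 1 / 2) + (∑ i, a i ^ 2) / (2 * c)) +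
      (1 + Real.exp l * (Measure.pi fun _ : Fin m => gaussianReal 0 c).real D) / 2 +
      (-1 + Real.log 2) := by
    rw [integral_add hi3 (integrable_const _),
      integral_add hi2 (hi1.div_const 2), integral_div, he1, hgi, he2]
    simp
  have h := hL.symm.trans_le (hmono.trans hR.le)
  linarith

/-- A change of measure bound for decoding regions: if no point lies in more than a fraction
`exp (-l)` of the regions `D s`, then the average probability of the region `D s` under the Gaussian
law centred at `a s` is at most of order `l⁻¹` times an average divergence. -/
lemma sum_measureReal_mul_le {m : ℕ} {c : NNReal} (hc : c ≠ 0) {ι : Type*} [Fintype ι]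
    (a : ι → Fin m → ℝ) {D : ι → Set (Fin m → ℝ)} (hD : ∀ s, MeasurableSet (D s)) {l : ℝ}
    (hcover : ∀ y, ∑ s, (D s).indicator (1 : (Fin m → ℝ) → ℝ) y ≤
      Real.exp (-l) * Fintype.card ι) :
    (∑ s, (noise m).real {w | a s + w ∈ D s}) * l ≤
      Fintype.card ι * (m * (Real.log c / 2 + 1 / (2 * c) - 1 / 2) + Real.log 2) +
        (∑ s, ∑ i, a s i ^ 2) / (2 * c) := by
  have h1 := Finset.sum_le_sum fun s (_ : s ∈ Finset.univ) => measureReal_mul_le hc (a s) (hD s) l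
  have h2 : ∑ s, (Measure.pi fun _ : Fin m => gaussianReal 0 c).real (D s) ≤
      Real.exp (-l) * Fintype.card ι := by
    have hi : ∀ s, Integrable ((D s).indicator (1 : (Fin m → ℝ) → ℝ))
        (Measure.pi fun _ : Fin m => gaussianReal 0 c) := fun s =>
      (integrable_const (1 : ℝ)).indicator (hD s)
    have h3 := integral_mono (integrable_finsetSum Finset.univ fun s _ => hi s)
      (integrable_const (Real.exp (-l) * Fintype.card ι)) hcover
    rw [integral_finsetSum _ fun s _ => hi s] at h3
    simp_rw [fun s => integral_indicator_one (μ := Measure.pi fun _ : Fin m => gaussianReal 0 c)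
      (hD s)] at h3
    simpa using h3
  have h4 : Real.exp l * ∑ s, (Measure.pi fun _ : Fin m => gaussianReal 0 c).real (D s) ≤
      Fintype.card ι := by
    refine (mul_le_mul_of_nonneg_left h2 (Real.exp_pos l).le).trans (le_of_eq ?_)
    rw [← mul_assoc, ← Real.exp_add]; simp
  rw [← Finset.sum_mul] at h1
  simp only [Finset.sum_add_distrib, Finset.sum_sub_distrib, ← Finset.sum_div, Finset.sum_const,
    Finset.card_univ, nsmul_eq_mul, ← Finset.mul_sum] at h1
  linarith

/-! ### The converse at a fixed dimension -/

lemma Estimator.measurableSet_of {m n : ℕ} (e : Estimator m n) (k : ℕ)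
    (Q : Finset (Fin n) → Prop) :
    MeasurableSet {p : (Fin m → ℝ) × Matrix (Fin m) (Fin n) ℝ | Q (e.toFun p.1 p.2 k)} := by
  have h : {p : (Fin m → ℝ) × Matrix (Fin m) (Fin n) ℝ | Q (e.toFun p.1 p.2 k)} =
      ⋃ t : {t : Finset (Fin n) // Q t}, {p | e.toFun p.1 p.2 k = t} := by
    ext p
    simp
  rw [h]
  exact MeasurableSet.iUnion fun t => e.measurable k t

lemma measurable_mulVec {m n : ℕ} (x : Fin n → ℝ) :
    Measurable fun A : Matrix (Fin m) (Fin n) ℝ => A.mulVec x := by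
  have hentry : ∀ i j, Measurable fun A : Matrix (Fin m) (Fin n) ℝ => A i j := fun i j =>
    (measurable_pi_apply j).comp (measurable_pi_apply (X := fun _ : Fin m => Fin n → ℝ) i)
  refine measurable_pi_lambda _ fun i => ?_
  change Measurable fun A : Matrix (Fin m) (Fin n) ℝ => ∑ j, A i j * x j
  exact Finset.measurable_sum _ fun j _ => (hentry i j).mul_const _

/-- The probability of correct decoding, as an average over the sampling matrix. -/
lemma integral_success {m n : ℕ} (M : SamplingMatrix m n) (e : Estimator m n) (α : ℝ)
    (x : Fin n → ℝ) :
    Integrable (fun A => (noise m).real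
      {w | distortion (pattern x) (e.toFun (A.mulVec x + w) A (pattern x).card) ≤ α}) M.law ∧
    ∫ A, (noise m).real
      {w | distortion (pattern x) (e.toFun (A.mulVec x + w) A (pattern x).card) ≤ α} ∂M.law =
      1 - (errorProb M e α x).toReal := by
  have := M.isProbabilityMeasure
  set E : Set (Matrix (Fin m) (Fin n) ℝ × (Fin m → ℝ)) := {p | α < distortion (pattern x)
      (e.toFun (p.1.mulVec x + p.2) p.1 (pattern x).card)} with hE
  have hEm : MeasurableSet E := by
    have hmeas : Measurable fun p : Matrix (Fin m) (Fin n) ℝ × (Fin m → ℝ) =>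
        (p.1.mulVec x + p.2, p.1) :=
      (((measurable_mulVec x).comp measurable_fst).add measurable_snd).prodMk measurable_fst
    exact hmeas (e.measurableSet_of (pattern x).card fun t => α < distortion (pattern x) t)
  have hsec : ∀ A, (noise m).real
      {w | distortion (pattern x) (e.toFun (A.mulVec x + w) A (pattern x).card) ≤ α} =
      1 - (noise m (Prod.mk A ⁻¹' E)).toReal := by
    intro A
    have h := probReal_compl_eq_one_sub (μ := noise m) (measurable_prodMk_left hEm : MeasurableSet
      (Prod.mk A ⁻¹' E))
    rw [Measure.real, Measure.real] at h
    rw [← h, Measure.real]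
    congr 2
    ext w
    simp [hE]
  have hm : Measurable fun A => noise m (Prod.mk A ⁻¹' E) := measurable_measure_prodMk_left hEm
  have hi : Integrable (fun A => (noise m (Prod.mk A ⁻¹' E)).toReal) M.law :=
    Integrable.of_bound hm.ennreal_toReal.aestronglyMeasurable 1 (ae_of_all _ fun A => by
      rw [Real.norm_of_nonneg ENNReal.toReal_nonneg]
      exact ENNReal.toReal_le_of_le_ofReal zero_le_one (by simpa using prob_le_one))
  simp_rw [hsec]
  refine ⟨(integrable_const _).sub hi, ?_⟩
  rw [integral_sub (integrable_const _) hi, integral_toReal hm.aemeasurable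
    (ae_of_all _ fun A => measure_lt_top _ _), errorProb, Measure.prod_apply hEm]
  simp

/-- The converse at a fixed dimension: if every rearrangement of `x` is recovered with error
probability at most `ε`, then the number of samples is at least of the order of the covering
exponent `l`. -/
lemma one_sub_mul_le_log {m n : ℕ} (hn : 2 ≤ n) (M : SamplingMatrix m n) (e : Estimator m n)
    (α : ℝ) (x : Fin n → ℝ) {l ε : ℝ} (hl : 0 ≤ l)
    (hcover : ∀ t : Finset (Fin n), t.card = (pattern x).card →
      ((Finset.univ.filter fun σ : Equiv.Perm (Fin n) =>
        distortion (pattern (x ∘ σ)) t ≤ α).card : ℝ) ≤ Real.exp (-l) * n.factorial)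
    (herr : ∀ σ : Equiv.Perm (Fin n), (errorProb M e α (x ∘ σ)).toReal ≤ ε) :
    (1 - ε) * l ≤
      m / 2 * Real.log (1 + (∑ i, (x i - (∑ j, x j) / n) ^ 2) / (n - 1)) + Real.log 2 := by
  have := M.isProbabilityMeasure
  have hn0 : (0 : ℝ) < n := by positivity
  have hn1 : (0 : ℝ) < (n : ℝ) - 1 := by
    have : (2 : ℝ) ≤ n := by exact_mod_cast hn
    linarith
  set μ : ℝ := (∑ j, x j) / n with hμ
  set z : Fin n → ℝ := fun i => x i - μ with hz
  have hz0 : ∑ i, z i = 0 := by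
    simp only [hz, Finset.sum_sub_distrib, Finset.sum_const, Finset.card_univ, Fintype.card_fin,
      nsmul_eq_mul, hμ]
    field_simp
    ring
  set K : ℝ := (∑ i, z i ^ 2) / (n - 1) with hK
  have hK0 : 0 ≤ K := div_nonneg (Finset.sum_nonneg fun i _ => sq_nonneg _) hn1.le
  change (1 - ε) * l ≤ m / 2 * Real.log (1 + K) + Real.log 2
  -- With this variance, `1 / (2 * c) + K / (2 * c) = 1 / 2`, so only `log c / 2` per sample remains
  -- of the averaged divergence bound.
  set c : NNReal := ⟨1 + K, by linarith⟩ with hc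
  have hcK : (c : ℝ) = 1 + K := rfl
  have hc0 : c ≠ 0 := by
    rw [← NNReal.coe_ne_zero, hcK]; linarith
  have hN : (Fintype.card (Equiv.Perm (Fin n)) : ℝ) = n.factorial := by
    rw [Fintype.card_perm, Fintype.card_fin]
  set s : Equiv.Perm (Fin n) → Matrix (Fin m) (Fin n) ℝ → ℝ := fun σ A => (noise m).real
    {w | distortion (pattern (x ∘ σ)) (e.toFun (A.mulVec (x ∘ σ) + w) A (pattern (x ∘ σ)).card)
      ≤ α} with hs
  have hsi : ∀ σ, Integrable (s σ) M.law := fun σ => (integral_success M e α (x ∘ σ)).1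
  have hpt : ∀ A, (∑ σ, s σ A) * l ≤
      n.factorial * (m * (Real.log c / 2 + 1 / (2 * c) - 1 / 2) + Real.log 2) +
        n.factorial * K / (2 * c) * (A * A.transpose).trace := by
    intro A
    -- The decoder knows `A`, so the known vector `A μ` is added back inside the decoding region,
    -- leaving the centred signal `A (z ∘ σ)`. For each `y` the estimate is one fixed set, so
    -- `hcover` bounds the number of regions containing `y`.
    set D : Equiv.Perm (Fin n) → Set (Fin m → ℝ) := fun σ => {y | distortion (pattern (x ∘ σ))
      (e.toFun (y + A.mulVec fun _ => μ) A (pattern x).card) ≤ α} with hD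
    have hDm : ∀ σ, MeasurableSet (D σ) := fun σ => by
      have hmeas : Measurable fun y : Fin m → ℝ => (y + A.mulVec fun _ => μ, A) := by fun_prop
      exact hmeas (e.measurableSet_of (pattern x).card
        fun t => distortion (pattern (x ∘ σ)) t ≤ α)
    have h := sum_measureReal_mul_le hc0 (fun σ : Equiv.Perm (Fin n) => A.mulVec (z ∘ σ)) hDm
      (l := l) fun y => by
        rw [hN]
        refine le_trans (le_of_eq ?_) (hcover (e.toFun (y + A.mulVec fun _ => μ) A (pattern x).card)
          (e.card_eq _ _ _ ((Finset.card_le_univ _).trans (Fintype.card_fin n).le)))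
        rw [Finset.card_filter]
        push_cast
        exact Finset.sum_congr rfl fun σ _ => by simp [hD, Set.indicator_apply]
    have hss : ∀ σ, (noise m).real {w | A.mulVec (z ∘ σ) + w ∈ D σ} = s σ A := by
      intro σ
      have hvec : A.mulVec (x ∘ σ) = A.mulVec (z ∘ σ) + A.mulVec fun _ => μ := by
        rw [← Matrix.mulVec_add]
        congr 1
        ext i
        simp [hz]
      simp only [hs, hD, Set.mem_ofPred_eq, card_pattern_comp_perm, hvec]
      simp only [add_right_comm]
    simp only [hss] at h
    refine h.trans ?_
    rw [hN]
    have h2 := sum_perm_mulVec_sq_le hn z hz0 A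
    have h3 : (∑ σ : Equiv.Perm (Fin n), ∑ i, A.mulVec (z ∘ σ) i ^ 2) / (2 * (c : ℝ)) ≤
        n.factorial * K / (2 * c) * (A * A.transpose).trace := by
      rw [div_mul_eq_mul_div]
      exact div_le_div_of_nonneg_right h2 (by positivity)
    linarith
  have hmono := integral_mono (μ := M.law)
    ((integrable_finsetSum Finset.univ fun σ _ => hsi σ).mul_const l)
    ((integrable_const (n.factorial * (m * (Real.log c / 2 + 1 / (2 * c) - 1 / 2) +
      Real.log 2))).add (M.integrable_trace.const_mul (n.factorial * K / (2 * c)))) hpt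
  have hL : ∫ A, (∑ σ, s σ A) * l ∂M.law =
      (∑ σ : Equiv.Perm (Fin n), (1 - (errorProb M e α (x ∘ σ)).toReal)) * l := by
    rw [integral_mul_const, integral_finsetSum _ fun σ _ => hsi σ]
    congr 1
    exact Finset.sum_congr rfl fun σ _ => (integral_success M e α (x ∘ σ)).2
  have hR : ∫ A : Matrix (Fin m) (Fin n) ℝ,
      ((n.factorial * (m * (Real.log c / 2 + 1 / (2 * c) - 1 / 2) + Real.log 2)) +
        n.factorial * K / (2 * c) * (A * A.transpose).trace) ∂M.law =
      n.factorial * (m * (Real.log c / 2 + 1 / (2 * c) - 1 / 2) + Real.log 2) +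
        n.factorial * K / (2 * c) * m := by
    rw [integral_add (integrable_const _) (M.integrable_trace.const_mul _), integral_const,
      integral_const_mul, M.integral_trace]
    simp
  have h := hL.symm.trans_le (hmono.trans hR.le)
  have hlow : n.factorial * (1 - ε) ≤
      ∑ σ : Equiv.Perm (Fin n), (1 - (errorProb M e α (x ∘ σ)).toReal) := by
    rw [← hN, ← nsmul_eq_mul, ← Finset.card_univ, ← Finset.sum_const]
    exact Finset.sum_le_sum fun σ _ => by linarith [herr σ]
  have hf0 : (0 : ℝ) < n.factorial := by positivity
  have h5 : (n.factorial : ℝ) * ((1 - ε) * l) ≤ n.factorial *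
      (m / 2 * Real.log (1 + K) + Real.log 2) := by
    refine le_trans (le_of_eq ?_) ((mul_le_mul_of_nonneg_right hlow hl).trans (h.trans
      (le_of_eq ?_)))
    · ring
    · rw [hcK]
      have : 1 + K ≠ 0 := by linarith
      field_simp
      ring
  exact le_of_mul_le_mul_left h5 hf0

/-! ### Truncated vectors and passage to the limit -/

/-- The vector of length `n` whose first `k` entries are those of `a`, the others being zero. -/
def truncated (a : ℕ → ℝ) (k n : ℕ) : Fin n → ℝ := fun i => if (i : ℕ) < k then a i else 0

lemma sum_fin_ite_lt {n k : ℕ} (hk : k ≤ n) (g : ℕ → ℝ) :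
    ∑ i : Fin n, (if (i : ℕ) < k then g i else 0) = ∑ i ∈ Finset.range k, g i := by
  rw [Fin.sum_univ_eq_sum_range (fun i => if i < k then g i else 0) n, ← Finset.sum_filter]
  congr 1
  ext i
  simp only [Finset.mem_filter, Finset.mem_range]
  omega

lemma card_pattern_filter_truncated {a : ℕ → ℝ} (ha : ∀ i, a i ≠ 0) {n k : ℕ} (hk : k ≤ n)
    (P : ℝ → Prop) [DecidablePred P] :
    (((pattern (truncated a k n)).filter fun i => P (truncated a k n i)).card : ℝ) =
      ((Finset.range k).filter fun i => P (a i)).card := by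
  rw [pattern, Finset.filter_filter, Finset.card_filter, Finset.card_filter]
  push_cast
  rw [← sum_fin_ite_lt hk]
  refine Finset.sum_congr rfl fun i _ => ?_
  by_cases h : (i : ℕ) < k
  · simp [truncated, h, ha]
  · simp [truncated, h]

lemma card_pattern_truncated {a : ℕ → ℝ} (ha : ∀ i, a i ≠ 0) {n k : ℕ} (hk : k ≤ n) :
    (pattern (truncated a k n)).card = k := by
  have h := card_pattern_filter_truncated ha hk (fun _ => True)
  simp only [Finset.filter_true, Finset.card_range] at h
  exact_mod_cast h

lemma empiricalCDF_comp_perm {n : ℕ} (x : Fin n → ℝ) (σ : Equiv.Perm (Fin n)) (t : ℝ) :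
    empiricalCDF (x ∘ σ) t = empiricalCDF x t := by
  rw [empiricalCDF, empiricalCDF, card_pattern_comp_perm]
  congr 2
  refine Finset.card_bij (fun i _ => σ i) ?_ ?_ ?_
  · intro i hi
    simpa [mem_pattern] using hi
  · intro i _ j _ h
    exact σ.injective h
  · intro j hj
    exact ⟨σ.symm j, by simpa [mem_pattern] using hj, by simp⟩

lemma floor_mul_le {Ω : ℝ} (h1 : Ω ≤ 1) (n : ℕ) : ⌊Ω * n⌋₊ ≤ n := by
  refine Nat.floor_le_of_le ?_
  have : (0 : ℝ) ≤ n := by positivity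
  nlinarith

/-- Both source conditions are invariant under permutation of coordinates, so the permutation may
vary arbitrarily with `n`. -/
lemma truncated_comp_perm_mem_source {Ω : ℝ} (h0 : 0 < Ω) (h1 : Ω ≤ 1) {F : Measure ℝ}
    {a : ℕ → ℝ} (ha : ∀ i, a i ≠ 0)
    (hF : TendstoUniformly
        (fun (n : ℕ) (t : ℝ) => (((Finset.range n).filter fun i => a i ≤ t).card : ℝ) / n)
        (fun t => cdf F t) atTop) (σ : (n : ℕ) → Equiv.Perm (Fin n)) :
    (fun n : ℕ => truncated a ⌊Ω * n⌋₊ n ∘ σ n) ∈ source Ω F := by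
  have hk := floor_mul_le h1
  refine ⟨fun n => ?_, fun u hu => ?_⟩
  · rw [card_pattern_comp_perm, card_pattern_truncated ha (hk n)]
  · filter_upwards [(tendsto_floor_mul_atTop h0).eventually (hF u hu)] with n hn t
    rw [empiricalCDF_comp_perm, empiricalCDF, card_pattern_truncated ha (hk n),
      card_pattern_filter_truncated ha (hk n) (fun y => y ≤ t)]
    exact hn t

lemma tendsto_variance_truncated {Ω : ℝ} (h0 : 0 < Ω) (h1 : Ω ≤ 1) {F : Measure ℝ}
    [IsProbabilityMeasure F] (hF2 : MemLp id 2 F) {a : ℕ → ℝ}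
    (ha1 : Tendsto (fun n : ℕ => (∑ i ∈ Finset.range n, a i) / n) atTop (𝓝 (∫ t, t ∂F)))
    (ha2 : Tendsto (fun n : ℕ => (∑ i ∈ Finset.range n, a i ^ 2) / n) atTop
      (𝓝 (∫ t, t ^ 2 ∂F))) :
    Tendsto (fun n : ℕ => (∑ i, (truncated a ⌊Ω * n⌋₊ n i -
      (∑ j, truncated a ⌊Ω * n⌋₊ n j) / n) ^ 2) / ((n : ℝ) - 1)) atTop (𝓝 (V Ω F)) := by
  have hk := floor_mul_le h1
  have hkt := tendsto_floor_mul_atTop h0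
  have hkn := tendsto_floor_mul_div h0.le
  have hV : V Ω F = (∫ t, t ^ 2 ∂F) * Ω - ((∫ t, t ∂F) * Ω) ^ 2 := by
    rw [V, variance_eq_sub hF2]
    simp only [Pi.pow_apply, id_eq]
    ring
  -- This factor converts normalisation by `n` into the `n - 1` that arises from sampling without
  -- replacement.
  have hn1 : Tendsto (fun n : ℕ => (n : ℝ) / ((n : ℝ) - 1)) atTop (𝓝 1) := by
    have h := tendsto_natCast_div_add_atTop (-1 : ℝ)
    simpa [sub_eq_add_neg] using h
  have hlim := (((ha2.comp hkt).mul hkn).sub (((ha1.comp hkt).mul hkn).pow 2)).mul hn1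
  rw [mul_one, ← hV] at hlim
  refine hlim.congr' ?_
  filter_upwards [hkt.eventually_gt_atTop 0, eventually_gt_atTop 1] with n hk0 hn
  have hk0' : (⌊Ω * n⌋₊ : ℝ) ≠ 0 := by positivity
  have hn0 : (n : ℝ) ≠ 0 := by positivity
  have hs1 : ∑ j, truncated a ⌊Ω * n⌋₊ n j = ∑ i ∈ Finset.range ⌊Ω * n⌋₊, a i :=
    sum_fin_ite_lt (hk n) a
  have hs2 : ∑ j, truncated a ⌊Ω * n⌋₊ n j ^ 2 = ∑ i ∈ Finset.range ⌊Ω * n⌋₊, a i ^ 2 := by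
    rw [← sum_fin_ite_lt (hk n)]
    refine Finset.sum_congr rfl fun i _ => ?_
    simp only [truncated]
    split_ifs <;> simp
  have hexp : ∀ c : ℝ, ∑ i, (truncated a ⌊Ω * n⌋₊ n i - c) ^ 2 =
      ∑ i, truncated a ⌊Ω * n⌋₊ n i ^ 2 - 2 * c * ∑ i, truncated a ⌊Ω * n⌋₊ n i + n * c ^ 2 := by
    intro c
    simp_rw [sub_sq]
    rw [Finset.sum_add_distrib, Finset.sum_sub_distrib, Finset.mul_sum]
    congr 2
    · exact Finset.sum_congr rfl fun i _ => by ring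
    · simp
  rw [hexp, hs1, hs2]
  simp only [Function.comp]
  field_simp
  ring

lemma V_nonneg {Ω : ℝ} (h0 : 0 ≤ Ω) (h1 : Ω ≤ 1) (F : Measure ℝ) : 0 ≤ V Ω F := by
  have := variance_nonneg id F
  have : 0 ≤ 1 - Ω := by linarith
  rw [V]; positivity

lemma R_le_of_achievable {Ω α ρ : ℝ} (hΩ0 : 0 < Ω) (hΩ : Ω ≤ 1 / 2) (hα0 : 0 ≤ α)
    (hα : α < 1 - Ω) (hρ : 0 ≤ ρ) {F : Measure ℝ} [IsProbabilityMeasure F] (hF2 : MemLp id 2 F)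
    (hF0 : F {0} = 0) (hR : 0 < R Ω α) (hach : Achievable (source Ω F) ρ α) :
    R Ω α ≤ ρ / 2 * Real.log (1 + V Ω F) := by
  have hΩ1 : Ω ≤ 1 := by linarith
  obtain ⟨M, e, hMe⟩ := hach
  obtain ⟨a, ha0, ha1, ha2, ha3⟩ := exists_empirical_sequence F hF2 hF0
  obtain ⟨r, hr, hcover⟩ := exists_covering_exponent hΩ0 hΩ hα0 hα
  -- Achievability is only pointwise in the sequence. The sequence of worst rearrangements itself
  -- lies in the source, which makes the error bound uniform over permutations.
  choose σ hσ using fun n : ℕ => Finite.exists_max fun σ : Equiv.Perm (Fin n) =>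
    errorProb (M n) (e n) α (truncated a ⌊Ω * n⌋₊ n ∘ σ)
  set ε : ℕ → ℝ := fun n =>
    (errorProb (M n) (e n) α (truncated a ⌊Ω * n⌋₊ n ∘ σ n)).toReal with hε
  have hε0 : Tendsto ε atTop (𝓝 0) := by
    have h := hMe _ (truncated_comp_perm_mem_source hΩ0 hΩ1 ha0 ha3 σ)
    exact (ENNReal.tendsto_toReal ENNReal.zero_ne_top).comp h
  have hVn := tendsto_variance_truncated hΩ0 hΩ1 hF2 ha1 ha2
  have hV := V_nonneg hΩ0.le hΩ1 F
  have hceil : Tendsto (fun n : ℕ => (⌈ρ * n⌉₊ : ℝ) / n) atTop (𝓝 ρ) :=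
    (tendsto_nat_ceil_mul_div_atTop hρ).comp tendsto_natCast_atTop_atTop
  have hlhs : Tendsto (fun n => (1 - ε n) * r n) atTop (𝓝 (R Ω α)) := by
    simpa using (hε0.const_sub 1).mul hr
  have hlog := (Real.continuousAt_log (by linarith : 1 + V Ω F ≠ 0)).tendsto.comp
    (hVn.const_add 1)
  have hrhs := ((hceil.div_const 2).mul hlog).add
    (tendsto_const_div_atTop_nhds_zero_nat (Real.log 2))
  rw [add_zero] at hrhs
  refine le_of_tendsto_of_tendsto hlhs hrhs ?_
  filter_upwards [hcover, hr.eventually (lt_mem_nhds hR), eventually_ge_atTop 2]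
    with n hcn hrn hn
  have hn0 : (0 : ℝ) < n := by positivity
  have hpat : (pattern (truncated a ⌊Ω * n⌋₊ n)).card = ⌊Ω * n⌋₊ :=
    card_pattern_truncated ha0 (floor_mul_le hΩ1 n)
  have := (M n).isProbabilityMeasure
  have h := one_sub_mul_le_log hn (M n) (e n) α (truncated a ⌊Ω * n⌋₊ n)
    (l := n * r n) (ε := ε n) (by positivity) (fun t ht => hcn _ t hpat (ht.trans hpat))
    (fun τ => ENNReal.toReal_mono (measure_ne_top _ _) (hσ n τ))
  have h' := div_le_div_of_nonneg_right h hn0.le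
  refine le_trans (le_of_eq ?_) (h'.trans (le_of_eq ?_))
  · field_simp
  · simp only [Function.comp]
    field_simp

end SparsityPattern

end

theorem proposition3 (Ω α : ℝ) (hΩ0 : 0 ≤ Ω) (hΩ : Ω ≤ 1 / 2) (hα0 : 0 ≤ α) (hα1 : α ≤ 1)
    (F : MeasureTheory.Measure ℝ) [MeasureTheory.IsProbabilityMeasure F]
    (hF2 : MeasureTheory.MemLp id 2 F) (hF0 : F {0} = 0) :
    ((2 * SparsityPattern.R Ω α / Real.log (1 + SparsityPattern.V Ω F) : ℝ) : EReal) ≤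
      SparsityPattern.rateDistortion (SparsityPattern.source Ω F) α := by
  refine le_sInf ?_
  rintro _ ⟨ρ, hρ, hach, rfl⟩
  rw [EReal.coe_le_coe_iff]
  have hlog : 0 ≤ Real.log (1 + SparsityPattern.V Ω F) :=
    Real.log_nonneg (by linarith [SparsityPattern.V_nonneg hΩ0 (by linarith) F])
  -- When `R ≤ 0`, which covers `Ω = 0` and `α ≥ 1 - Ω`, the quotient is nonpositive and `0 ≤ ρ`
  -- suffices.
  rcases le_or_gt (SparsityPattern.R Ω α) 0 with hR | hR
  · exact (div_nonpos_of_nonpos_of_nonneg (by linarith) hlog).trans hρ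
  · have hα : α < 1 - Ω := by
      by_contra h
      rw [SparsityPattern.R, if_neg h] at hR
      exact lt_irrefl _ hR
    have hΩpos : 0 < Ω := by
      refine hΩ0.lt_of_ne fun h => ?_
      rw [SparsityPattern.R, if_pos hα, ← h] at hR
      simp at hR
    have hle := SparsityPattern.R_le_of_achievable hΩpos hΩ hα0 hα hρ hF2 hF0 hR hach
    -- If the logarithm vanished, achievability would force `R ≤ 0`. Hence for `V = 0` and `R > 0`
    -- no rate is achievable, and the convention for division by zero plays no role.
    have hlog' : 0 < Real.log (1 + SparsityPattern.V Ω F) := by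
      refine hlog.lt_of_ne fun h => ?_
      rw [← h, mul_zero] at hle
      linarith
    rw [div_le_iff₀ hlog']
    linarith
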